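/- **Setting.** Let $L>1$, let $\nu_1,\dots,\nu_N\in\mathbb R^2$ with $\nu_i=0$ for some $i$, let $\Psi_i(x)=x/L+\nu_i$, and let $\mathcal K^{\langle 0\rangle}$ be the unique nonempty compact set with $\mathcal K^{\langle 0\rangle}=\bigcup_{i=1}^N\Psi_i(\mathcal K^{\langle 0\rangle})$. Let $F$ be the set of fixed points of $\Psi_1,\dots,\Psi_N$, and let $V$ be the set of *essential fixed points*, i.e. of those $x\in F$ for which there are $y\in F$, $y\ne x$, and $i\neq j$ with $\Psi_i(x)=\Psi_j(y)$; put $k=\#V$. Assume that $\mathcal K^{\langle 0\rangle}$ is a *simple nested fractal*: (1) $k\ge 2$; (2) there is a nonempty open $U\subset\mathbb R^2$ with $\Psi_i(U)\cap\Psi_j(U)=\emptyset$ for $i\ne j$ and $\bigcup_i\Psi_i(U)\subseteq U$; (3) $\Psi_i(\mathcal K^{\langle 0\rangle})\cap\Psi_j(\mathcal K^{\langle 0\rangle})=\Psi_i(V)\cap\Psi_j(V)$ for $i\ne j$; (4) for all distinct $x,y\in V$ and all $i$ there is $j$ with $S_{x,y}(\Psi_i(V))=\Psi_j(V)$, where $S_{x,y}$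 is the reflection in the perpendicular bisector of $[x,y]$; (5) the graph on $\bigcup_i\Psi_i(V)$ in which two distinct points are joined when both lie in $\Psi_i(\mathcal K^{\langle 0\rangle})$ for some $i$ is connected. For $M\in\mathbb Z$ let $\mathcal K^{\langle M\rangle}=L^M\mathcal K^{\langle 0\rangle}$ and $V_M^{\langle M\rangle}=L^MV$, and let $\mathcal K^{\langle\infty\rangle}=\bigcup_{M\ge 0}\mathcal K^{\langle M\rangle}$. An *$M$-complex* is a set $\Delta=\mathcal K^{\langle M\rangle}+\nu_\Delta\subset\mathcal K^{\langle\infty\rangle}$ with $\nu_\Delta=\sum_{j=M+1}^{J}L^j\nu_{i_j}$ for some $J\ge M+1$ and some indices $i_j$; its vertices are the points of $V(\Delta)=V_M^{\langle M\rangle}+\nu_\Delta$. Let $V_0^{\langle 0\rangle}=V$, $V_0^{\langle m+1\rangle}=\bigcup_i\bigl(V_0^{\langle m\rangle}+L^{m+1}\nu_i\bigr)$, $V_0^{\langle\infty\rangle}=\bigcup_{m\ge0}V_0^{\langle m\rangle}$ and $V_M^{\langle\infty\rangle}=L^MV_0^{\langle\infty\rangle}$. Let $\mathcal A$ be an alphabet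 of $k$ symbols and let $\mathcal R_M$ be the set of the $k$ rotations by the angles $2\pi i/k$, $i=1,\dots,k$, about the barycenter of $V_M^{\langle M\rangle}$. The fractal $\mathcal K^{\langle\infty\rangle}$ has the *good labelling property* (GLP) if for some $M\in\mathbb Z$ there is a map $\ell:V_M^{\langle\infty\rangle}\to\mathcal A$ such that $\ell|_{V_M^{\langle M\rangle}}$ is a bijection onto $\mathcal A$ and for every $M$-complex $\Delta$ there is $R_\Delta\in\mathcal R_M$ with $\ell(v)=\ell(R_\Delta(v-\nu_\Delta))$ for all $v\in V(\Delta)$. Two $0$-complexes are *adjacent* if they are distinct and have a common vertex. A *cycle of $0$-complexes in $\mathcal K^{\langle 1\rangle}$* is a finite sequence of pairwise distinct $0$-complexes contained in $\mathcal K^{\langle 1\rangle}$, each adjacent to the next one and the last one adjacent to the first. In such a cycle (read cyclically, including the step from the last complex to the first) a *rotation by the angle $\alpha$* occurs at a step if the next complex is the image of the previous one under the counter-clockwise rotation by $\alpha$ about a common vertex of the two. **Theorem.** If $k$ is odd, then the following are equivalent: (A) $\mathcal K^{\langle\infty\rangle}$ has GLP; (B) every cycle of $0$-complexes in $\mathcal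 K^{\langle 1\rangle}$ satisfies $k\mid(c-d)$, where $c$ is the number of rotations by $\frac{k+1}{k}\pi$ and $d$ the number of rotations by $\frac{k-1}{k}\pi$ that occur in the cycle. -/

import Mathlib

open Set Topology

noncomputable section

/-- A system of similitudes `Ψ_i(x) = x / L + ν_i`, `i ∈ {1, …, N}`, of the plane `ℝ² = ℂ`,
with common scaling factor `L > 1`. -/
structure PlanarIFS where
  N : ℕ
  N_pos : 0 < N
  L : ℝ
  one_lt_L : 1 < L
  ν : Fin N → ℂ

namespace PlanarIFS

variable (S : PlanarIFS)

/-- The similitude `Ψ_i`. -/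
def Ψ (i : Fin S.N) (x : ℂ) : ℂ := x / (S.L : ℂ) + S.ν i

lemma L_pos : 0 < S.L := lt_trans one_pos S.one_lt_L

lemma L_ne_zero : (S.L : ℂ) ≠ 0 := Complex.ofReal_ne_zero.mpr S.L_pos.ne'

lemma dist_Ψ (i : Fin S.N) (x y : ℂ) : dist (S.Ψ i x) (S.Ψ i y) = S.L⁻¹ * dist x y := by
  have h : S.Ψ i x - S.Ψ i y = (x - y) / (S.L : ℂ) := by
    unfold Ψ
    ring
  rw [dist_eq_norm, dist_eq_norm, h, norm_div, Complex.norm_real, Real.norm_eq_abs,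
    abs_of_pos S.L_pos, div_eq_inv_mul]

/-- A set is generated by the system if it is nonempty, compact and equal to the union of its
images under the similitudes. -/
def IsGenerated (K : Set ℂ) : Prop :=
  K.Nonempty ∧ IsCompact K ∧ K = ⋃ i, S.Ψ i '' K

/-- The point with address `w`. -/
def coding (w : ℕ → Fin S.N) : ℂ := ∑' n, S.ν (w n) / (S.L : ℂ) ^ n

lemma coding_bound : ∃ C : ℝ, ∀ i, ‖S.ν i‖ ≤ C :=
  ⟨∑ i, ‖S.ν i‖, fun i =>
    Finset.single_le_sum (f := fun i => ‖S.ν i‖) (fun _ _ => norm_nonneg _) (Finset.mem_univ i)⟩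

lemma coding_term_bound {C : ℝ} (hC : ∀ i, ‖S.ν i‖ ≤ C) (n : ℕ) (w : ℕ → Fin S.N) :
    ‖S.ν (w n) / (S.L : ℂ) ^ n‖ ≤ C * S.L⁻¹ ^ n := by
  rw [norm_div, norm_pow, Complex.norm_real, Real.norm_eq_abs, abs_of_pos S.L_pos, inv_pow,
    div_eq_mul_inv]
  exact mul_le_mul_of_nonneg_right (hC _) (inv_nonneg.mpr (pow_nonneg S.L_pos.le n))

lemma summable_geom (C : ℝ) : Summable fun n : ℕ => C * S.L⁻¹ ^ n :=
  (summable_geometric_of_lt_one (inv_nonneg.mpr S.L_pos.le)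
    (inv_lt_one_of_one_lt₀ S.one_lt_L)).mul_left C

lemma continuous_coding : Continuous S.coding := by
  obtain ⟨C, hC⟩ := S.coding_bound
  refine continuous_tsum (u := fun n : ℕ => C * S.L⁻¹ ^ n) (fun n => ?_) (S.summable_geom C)
    (fun n w => S.coding_term_bound hC n w)
  exact ((continuous_of_discreteTopology (f := S.ν)).comp (continuous_apply n)).div_const _

lemma coding_eq (w : ℕ → Fin S.N) :
    S.coding w = S.Ψ (w 0) (S.coding fun n => w (n + 1)) := by
  obtain ⟨C, hC⟩ := S.coding_bound
  have hs : Summable fun n => S.ν (w n) / (S.L : ℂ) ^ n :=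
    Summable.of_norm_bounded (S.summable_geom C) (fun n => S.coding_term_bound hC n w)
  unfold coding Ψ
  rw [hs.tsum_eq_zero_add, ← tsum_div_const, add_comm]
  simp [pow_succ, div_div]

lemma exists_isGenerated : ∃ K, S.IsGenerated K := by
  have : Nonempty (Fin S.N) := ⟨⟨0, S.N_pos⟩⟩
  refine ⟨range S.coding, range_nonempty _, isCompact_range S.continuous_coding, ?_⟩
  ext x
  simp only [mem_range, mem_iUnion, mem_image, exists_exists_eq_and]
  constructor
  · rintro ⟨w, rfl⟩
    exact ⟨w 0, fun n => w (n + 1), (S.coding_eq w).symm⟩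
  · rintro ⟨i, w, rfl⟩
    exact ⟨fun n => Nat.casesOn n i w, S.coding_eq _⟩

lemma IsGenerated.subset {S : PlanarIFS} {K K' : Set ℂ} (h : S.IsGenerated K)
    (h' : S.IsGenerated K') : K ⊆ K' := by
  obtain ⟨hn, hc, he⟩ := h
  obtain ⟨hn', hc', he'⟩ := h'
  obtain ⟨x₀, hx₀, hmax⟩ := hc.exists_isMaxOn hn
    (Metric.continuous_infDist_pt K').continuousOn
  obtain ⟨i, y, hy, rfl⟩ : ∃ i, ∃ y ∈ K, S.Ψ i y = x₀ := by
    rw [he] at hx₀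
    simpa using hx₀
  obtain ⟨z, hz, hyz⟩ := hc'.exists_infDist_eq_dist hn' y
  have hz' : S.Ψ i z ∈ K' := by
    rw [he']
    exact mem_iUnion.mpr ⟨i, z, hz, rfl⟩
  have h1 : Metric.infDist (S.Ψ i y) K' ≤ S.L⁻¹ * Metric.infDist y K' := by
    rw [hyz, ← S.dist_Ψ i]
    exact Metric.infDist_le_dist_of_mem hz'
  have h2 : Metric.infDist y K' ≤ Metric.infDist (S.Ψ i y) K' := hmax hy
  have h3 : S.L⁻¹ < 1 := inv_lt_one_of_one_lt₀ S.one_lt_L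
  have h4 : 0 ≤ Metric.infDist y K' := Metric.infDist_nonneg
  have h5 : Metric.infDist (S.Ψ i y) K' ≤ 0 := by
    by_contra hlt
    push Not at hlt
    rcases h4.eq_or_lt with h0 | h0
    · rw [← h0, mul_zero] at h1
      linarith
    · nlinarith
  intro x hx
  have h6 : Metric.infDist x K' = 0 := le_antisymm (le_trans (hmax hx) h5) Metric.infDist_nonneg
  exact (hc'.isClosed.mem_iff_infDist_zero hn').mpr h6

/-- There is exactly one nonempty compact set `K` with `K = ⋃ i, Ψ_i(K)`. -/
theorem existsUnique_isGenerated : ∃! K, S.IsGenerated K := by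
  obtain ⟨K, hK⟩ := S.exists_isGenerated
  exact ⟨K, hK, fun K' hK' => Subset.antisymm (hK'.subset hK) (hK.subset hK')⟩

/-- The fractal `𝒦^⟨0⟩` generated by the system. -/
def K0 : Set ℂ := Classical.choose S.existsUnique_isGenerated

lemma isGenerated_K0 : S.IsGenerated S.K0 := (Classical.choose_spec S.existsUnique_isGenerated).1

/-- The set `F` of fixed points of the similitudes. -/
def fixedPts : Set ℂ := {x | ∃ i, S.Ψ i x = x}

/-- The set `V_0^⟨0⟩` of essential fixed points. -/
def V : Set ℂ :=
  {x | x ∈ S.fixedPts ∧ ∃ y ∈ S.fixedPts, y ≠ x ∧ ∃ i j, i ≠ j ∧ S.Ψ i x = S.Ψ j y}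

lemma finite_fixedPts : S.fixedPts.Finite := by
  have h1 : (1 - (S.L : ℂ)⁻¹) ≠ 0 := by
    rw [sub_ne_zero, ne_comm, inv_ne_one]
    exact_mod_cast S.one_lt_L.ne'
  refine (finite_range fun i => S.ν i / (1 - (S.L : ℂ)⁻¹)).subset ?_
  rintro x ⟨i, hi⟩
  refine ⟨i, ?_⟩
  simp only
  rw [div_eq_iff h1, ← sub_eq_zero]
  unfold Ψ at hi
  rw [div_eq_mul_inv] at hi
  linear_combination hi

lemma finite_V : S.V.Finite := S.finite_fixedPts.subset fun _ hx => hx.1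

/-- The number `k` of essential fixed points. -/
def k : ℕ := S.V.ncard

/-- The set `V_{-1}^⟨0⟩ = ⋃ i, Ψ_i(V_0^⟨0⟩)`. -/
def Vneg1 : Set ℂ := ⋃ i, S.Ψ i '' S.V

/-- The graph on `V_{-1}^⟨0⟩` joining two distinct points that lie in a common `Ψ_i(𝒦^⟨0⟩)`. -/
def cellGraph : SimpleGraph S.Vneg1 :=
  SimpleGraph.fromRel fun x y => ∃ i, (x : ℂ) ∈ S.Ψ i '' S.K0 ∧ (y : ℂ) ∈ S.Ψ i '' S.K0

instance (x y : ℂ) : Nonempty (AffineSubspace.perpBisector x y) :=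
  AffineSubspace.perpBisector_nonempty.to_subtype

/-- The symmetry `S_{x,y}` with respect to the line bisecting the segment `[x, y]`
perpendicularly. -/
def bisectorSymmetry (x y : ℂ) : ℂ → ℂ :=
  EuclideanGeometry.reflection (AffineSubspace.perpBisector x y)

/-- The fractal generated by the system is a simple nested fractal. -/
structure IsSimpleNested : Prop where
  two_le_k : 2 ≤ S.k
  openSet : ∃ U : Set ℂ, IsOpen U ∧ U.Nonempty ∧
    (∀ i j, i ≠ j → S.Ψ i '' U ∩ S.Ψ j '' U = ∅) ∧ (⋃ i, S.Ψ i '' U) ⊆ U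
  nesting : ∀ i j, i ≠ j →
    S.Ψ i '' S.K0 ∩ S.Ψ j '' S.K0 = S.Ψ i '' S.V ∩ S.Ψ j '' S.V
  symmetry : ∀ i, ∀ x ∈ S.V, ∀ y ∈ S.V, x ≠ y →
    ∃ j, bisectorSymmetry x y '' (S.Ψ i '' S.V) = S.Ψ j '' S.V
  connectivity : S.cellGraph.Connected

/-- `𝒦^⟨M⟩ = L^M 𝒦^⟨0⟩` for `M ∈ ℤ`. -/
def K (M : ℤ) : Set ℂ := (fun z => (S.L : ℂ) ^ M * z) '' S.K0

/-- The unbounded fractal `𝒦^⟨∞⟩ = ⋃ M ≥ 0, 𝒦^⟨M⟩`. -/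
def Kinf : Set ℂ := ⋃ M : ℕ, S.K M

/-- `V_M^⟨M⟩ = L^M V_0^⟨0⟩`, the vertices of `𝒦^⟨M⟩`. -/
def VM (M : ℤ) : Set ℂ := (fun z => (S.L : ℂ) ^ M * z) '' S.V

/-- The translate `𝒦^⟨M⟩ + a`. -/
def complexSet (M : ℤ) (a : ℂ) : Set ℂ := (fun z => z + a) '' S.K M

/-- The vertices `V_M^⟨M⟩ + a` of the `M`-complex `𝒦^⟨M⟩ + a`. -/
def vertices (M : ℤ) (a : ℂ) : Set ℂ := (fun z => z + a) '' S.VM M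

/-- `𝒦^⟨M⟩ + a` is an `M`-complex: it lies in `𝒦^⟨∞⟩` and `a = ∑_{j=M+1}^J L^j ν_{i_j}` for some
`J ≥ M + 1` and some indices `i_j`. (A complex determines its translation vector `a`, see
`complexSet_injective`, so complexes are represented by these vectors.) -/
def IsComplexShift (M : ℤ) (a : ℂ) : Prop :=
  S.complexSet M a ⊆ S.Kinf ∧
    ∃ J : ℤ, M + 1 ≤ J ∧ ∃ w : ℤ → Fin S.N,
      a = ∑ j ∈ Finset.Icc (M + 1) J, (S.L : ℂ) ^ j * S.ν (w j)

lemma complexSet_injective (M : ℤ) : Function.Injective (S.complexSet M) := by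
  intro a b hab
  by_contra hne
  obtain ⟨hn, hc, -⟩ := S.isGenerated_K0
  have hc' : IsCompact (S.K M) := hc.image (continuous_const.mul continuous_id)
  obtain ⟨x, hx⟩ : (S.K M).Nonempty := hn.image _
  have hstep : ∀ y ∈ S.K M, y + (a - b) ∈ S.K M := by
    intro y hy
    have h1 : y + a ∈ S.complexSet M b := hab ▸ ⟨y, hy, rfl⟩
    obtain ⟨z, hz, hzy⟩ := h1
    have : y + (a - b) = z := by
      simp only at hzy
      linear_combination -hzy
    rwa [this]
  have hall : ∀ n : ℕ, x + n * (a - b) ∈ S.K M := by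
    intro n
    induction n with
    | zero => simpa using hx
    | succ n ih =>
      have := hstep _ ih
      push_cast
      convert this using 1
      ring
  obtain ⟨C, hC⟩ := hc'.isBounded.exists_norm_le
  have hpos : 0 < ‖a - b‖ := norm_pos_iff.mpr (sub_ne_zero.mpr hne)
  obtain ⟨n, hn'⟩ := exists_nat_gt ((C + ‖x‖) / ‖a - b‖)
  rw [div_lt_iff₀ hpos] at hn'
  have h2 := hC _ (hall n)
  have h3 : ‖(n : ℂ) * (a - b)‖ ≤ ‖x + n * (a - b)‖ + ‖x‖ := by
    simpa using norm_sub_le (x + n * (a - b)) x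
  rw [norm_mul, Complex.norm_natCast] at h3
  linarith

/-- `V_0^⟨m⟩`, the vertices of the `0`-complexes inside `𝒦^⟨m⟩`, by
`V_0^⟨m+1⟩ = ⋃ i, (V_0^⟨m⟩ + L^(m+1) ν_i)`. -/
def V0 : ℕ → Set ℂ
  | 0 => S.V
  | m + 1 => ⋃ i, (fun z => z + (S.L : ℂ) ^ (m + 1) * S.ν i) '' V0 m

/-- `V_0^⟨∞⟩ = ⋃ m ≥ 0, V_0^⟨m⟩`. -/
def V0inf : Set ℂ := ⋃ m : ℕ, S.V0 m

/-- `V_M^⟨∞⟩ = L^M V_0^⟨∞⟩`. -/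
def VMinf (M : ℤ) : Set ℂ := (fun z => (S.L : ℂ) ^ M * z) '' S.V0inf

lemma VM_subset_VMinf (M : ℤ) : S.VM M ⊆ S.VMinf M :=
  image_mono fun _ hx => mem_iUnion.mpr ⟨0, hx⟩

lemma add_sum_mem_V0 {x : ℂ} (hx : x ∈ S.V) (w : ℕ → Fin S.N) (m : ℕ) :
    x + ∑ j ∈ Finset.range m, (S.L : ℂ) ^ (j + 1) * S.ν (w j) ∈ S.V0 m := by
  induction m with
  | zero => simpa [V0] using hx
  | succ m ih =>
    refine mem_iUnion.mpr ⟨w m, _, ih, ?_⟩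
    simp only [Finset.sum_range_succ]
    ring

/-- The vertices of every `M`-complex belong to `V_M^⟨∞⟩`. -/
lemma vertices_subset_VMinf {M : ℤ} {a : ℂ} (ha : S.IsComplexShift M a) :
    S.vertices M a ⊆ S.VMinf M := by
  obtain ⟨-, J, hJ, w, rfl⟩ := ha
  obtain ⟨m, rfl⟩ : ∃ m : ℕ, J = M + m := ⟨(J - M).toNat, by omega⟩
  rintro _ ⟨_, ⟨x, hx, rfl⟩, rfl⟩
  refine ⟨_, mem_iUnion.mpr ⟨m, S.add_sum_mem_V0 hx (fun j => w (M + 1 + j)) m⟩, ?_⟩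
  have hsum : ∑ j ∈ Finset.Icc (M + 1) (M + m), (S.L : ℂ) ^ j * S.ν (w j) =
      ∑ j ∈ Finset.range m, (S.L : ℂ) ^ (M + 1 + j) * S.ν (w (M + 1 + j)) := by
    symm
    refine Finset.sum_bij (fun j _ => M + 1 + (j : ℤ)) ?_ ?_ ?_ ?_
    · intro j hj
      rw [Finset.mem_range] at hj
      rw [Finset.mem_Icc]
      omega
    · intro j _ j' _ h
      omega
    · intro b hb
      rw [Finset.mem_Icc] at hb
      exact ⟨(b - M - 1).toNat, by rw [Finset.mem_range]; omega, by omega⟩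
    · intro j _
      rfl
  simp only
  rw [hsum, mul_add, Finset.mul_sum]
  congr 1
  refine Finset.sum_congr rfl fun j _ => ?_
  rw [← mul_assoc, add_assoc, zpow_add₀ S.L_ne_zero, add_comm (1 : ℤ) (j : ℤ)]
  norm_cast

/-- Counter-clockwise rotation of the plane by the angle `θ` about the point `c`. -/
def rot (c : ℂ) (θ : ℝ) (z : ℂ) : ℂ := c + Complex.exp (θ * Complex.I) * (z - c)

/-- The barycenter of `𝒦^⟨M⟩`, i.e. the mean of its vertices. -/
def barycenter (M : ℤ) : ℂ := (∑ v ∈ S.finite_V.toFinset, (S.L : ℂ) ^ M * v) / (S.k : ℂ)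

/-- The set `ℛ_M` of the rotations `R_1, …, R_k` about the barycenter of `𝒦^⟨M⟩`, where `R_i` has
angle `2πi/k`. -/
def rotations (M : ℤ) : Set (ℂ → ℂ) :=
  {R | ∃ i ∈ Finset.Icc 1 S.k, R = rot (S.barycenter M) (2 * Real.pi * i / S.k)}

/-- `ℓ : V_M^⟨∞⟩ → {1, …, k}` is a good labelling function of order `M`. In the second clause the
vertices `v` of the complex `𝒦^⟨M⟩ + a` lie in `V_M^⟨∞⟩` by `vertices_subset_VMinf`; the clause says
`ℓ(v) = ℓ(R(v - a))`. -/
def IsGoodLabelling (M : ℤ) (ℓ : S.VMinf M → Fin S.k) : Prop :=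
  BijOn ℓ {v | (v : ℂ) ∈ S.VM M} univ ∧
    ∀ a, S.IsComplexShift M a → ∃ R ∈ S.rotations M,
      ∀ v : S.VMinf M, (v : ℂ) ∈ S.vertices M a →
        ∃ u : S.VMinf M, (u : ℂ) = R (v - a) ∧ ℓ v = ℓ u

/-- The good labelling property. -/
def HasGLP : Prop := ∃ M : ℤ, ∃ ℓ : S.VMinf M → Fin S.k, S.IsGoodLabelling M ℓ

/-- `𝒦^⟨0⟩ + a` is a `0`-complex contained in `𝒦^⟨1⟩`. -/
def IsInnerComplex (a : ℂ) : Prop := S.IsComplexShift 0 a ∧ S.complexSet 0 a ⊆ S.K 1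

/-- Two `0`-complexes are adjacent if they are distinct and have a common vertex. -/
def Adjacent (a b : ℂ) : Prop :=
  S.complexSet 0 a ≠ S.complexSet 0 b ∧ (S.vertices 0 a ∩ S.vertices 0 b).Nonempty

/-- A cycle of `0`-complexes in `𝒦^⟨1⟩`: a sequence of distinct `0`-complexes, each adjacent to
the next one and the last one adjacent to the first (indices are taken modulo the length). -/
structure IsCycle {n : ℕ} [NeZero n] (Δ : Fin n → ℂ) : Prop where
  inner : ∀ i, S.IsInnerComplex (Δ i)
  distinct : Function.Injective fun i => S.complexSet 0 (Δ i)
  adjacent : ∀ i, S.Adjacent (Δ i) (Δ (i + 1))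

/-- The complex `𝒦^⟨0⟩ + b` arises from `𝒦^⟨0⟩ + a` by the rotation by the angle `θ` about a
common vertex. -/
def ArisesByRotation (θ : ℝ) (a b : ℂ) : Prop :=
  ∃ v ∈ S.vertices 0 a ∩ S.vertices 0 b, rot v θ '' S.complexSet 0 a = S.complexSet 0 b

/-- The number of rotations by the angle `θ` that occur in a cycle. -/
def rotationCount {n : ℕ} [NeZero n] (θ : ℝ) (Δ : Fin n → ℂ) : ℕ :=
  {i | S.ArisesByRotation θ (Δ i) (Δ (i + 1))}.ncard

end PlanarIFS

end

/-!
The proof reduces both properties to the existence of *rotation numbers*: a map `r` from the cells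
`p` of `𝒦^⟨0⟩` to `ℤ/k` such that, whenever the vertex number `s` of cell `p` is the vertex number
`t` of cell `q`, `s + r p = t + r q` (`IsRotationNumber`).

*Geometry.* Since `k` is odd, `k ≥ 3`. The bisector symmetries have a common fixed point, and they
preserve `V`, which is therefore the vertex set `g + ρ ω^s`, `s ∈ ℤ/k`, of a regular polygon
(`exists_isPolygon`); all symmetries of this polygon preserve `𝒦^⟨0⟩`. Two cells with a common
vertex are translates of each other, hence also images under a rotation by `t - s` steps about this
vertex. The key point is that this rotation is one by `(k ± 1) / 2` steps
(`IsPolygon.opposite_of_linked`). Indeed, the line `ℓ` through the common vertex `v` perpendicular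
to the segment joining the centers is the axis of a reflection exchanging the two cells, so a point
of `ℓ` in one cell lies in both, and by nesting `ℓ` meets the cells in `v` only. If `v` were not
opposite in the above sense, `ℓ` would separate other vertices of the cell, and then `v` would be a
cut point of the connected set `𝒦^⟨0⟩` separating essential fixed points. By rotational symmetry each
essential fixed point would separate others, which is impossible for a finite set of points in a
connected set (`not_separated`).

*Cycles.* By the key point the steps `t - s` along a cycle add up to `(c - d) (k + 1) / 2` modulo
`k`, and `(k + 1) / 2` is invertible modulo the odd number `k` (`sum_steps_eq`). So the condition on
cycles says that the steps have sum zero along each cycle of cells, i.e. that they are the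
differences of a potential, which is a system of rotation numbers (`exists_potential`).

*Labellings.* The rotations `R_Δ` of a good labelling for the `M`-complexes in `𝒦^⟨M+1⟩` give rotation
numbers. Conversely, rotation numbers label the vertices in `𝒦^⟨1⟩`. A rotation of the polygon
changes the rotation numbers by a constant because the cells are connected, so the labels of the
corners of `𝒦^⟨1⟩` depend on their numbers in an affine way, with some slope `c`. Hence multiplying
the rotation numbers by `c`, one can label `𝒦^⟨2⟩`, and so on with `c^m` for `𝒦^⟨m+1⟩`
(`IsRotationNumber.exists_label`).
-/

open scoped ComplexConjugate

/-! ### Potentials of relations without holonomy -/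

/-- A relation on `α × A` that is symmetric and invariant under translation of the second
coordinate has a potential if every cycle of the relation over `α` without repetitions closes up
in `A`: a closed walk over `α` of minimal length that does not close up in `A` would have no
repetitions, because removing a loop or keeping only the loop shortens it. -/
lemma exists_potential {α A : Type*} [AddCommGroup A] [Nonempty α] (E : α × A → α × A → Prop)
    (hsymm : ∀ a b, E a b → E b a)
    (htrans : ∀ p q x y z, E (p, x) (q, y) → E (p, x + z) (q, y + z))
    (hconn : ∀ p q, Relation.ReflTransGen (fun p q => ∃ x y, E (p, x) (q, y)) p q)
    (hcyc : ∀ n : ℕ, 0 < n → ∀ c : ℕ → α × A, (∀ i < n, E (c i) (c (i + 1))) →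
      (c n).1 = (c 0).1 → InjOn (fun i => (c i).1) (Iio n) → (c n).2 = (c 0).2) :
    ∃ r : α → A, ∀ p q x y, E (p, x) (q, y) → x + r p = y + r q := by
  have hclosed : ∀ n : ℕ, ∀ c : ℕ → α × A, (∀ i < n, E (c i) (c (i + 1))) →
      (c n).1 = (c 0).1 → (c n).2 = (c 0).2 := by
    intro n
    induction n using Nat.strong_induction_on with
    | _ n ih =>
    intro c hc hn
    rcases Nat.eq_zero_or_pos n with rfl | hpos
    · rfl
    by_cases hinj : InjOn (fun i => (c i).1) (Iio n)
    · exact hcyc n hpos c hc hn hinj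
    obtain ⟨i, j, hij, hjn, heq⟩ : ∃ i j, i < j ∧ j < n ∧ (c i).1 = (c j).1 := by
      simp only [InjOn, mem_Iio, not_forall] at hinj
      obtain ⟨i, hi, j, hj, h, hne⟩ := hinj
      rcases lt_or_gt_of_ne hne with hlt | hlt
      · exact ⟨i, j, hlt, hj, h⟩
      · exact ⟨j, i, hlt, hi, h.symm⟩
    -- the part between the repetitions `i` and `j` closes up, so it can be removed
    have hloop : c j = c i := by
      have h1 : i + (j - i) = j := by omega
      have h2 := ih (j - i) (by omega) (fun l => c (i + l)) (fun l hl => hc (i + l) (by omega))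
        (by simp only [h1, add_zero]; exact heq.symm)
      simp only [h1, add_zero] at h2
      exact Prod.ext heq.symm h2
    have h3 := ih (n - (j - i)) (by omega) (fun l => if l ≤ i then c l else c (l + (j - i)))
      (by
        intro l hl
        rcases lt_trichotomy l i with h | h | h
        · simp only [h.le, Nat.succ_le_of_lt h, if_true]
          exact hc l (by omega)
        · subst h
          have h4 : l + 1 + (j - l) = j + 1 := by omega
          simp only [le_refl, if_true, Nat.not_succ_le_self, if_false, h4]
          rw [← hloop]
          exact hc j hjn
        · have h4 : ¬ l ≤ i := by omega
          have h5 : ¬ l + 1 ≤ i := by omega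
          have h6 : l + 1 + (j - i) = l + (j - i) + 1 := by omega
          simp only [h4, h5, if_false, h6]
          exact hc _ (by omega))
    have h4 : ¬ n - (j - i) ≤ i := by omega
    have h5 : n - (j - i) + (j - i) = n := by omega
    simp only [h4, if_false, Nat.zero_le, if_true, h5] at h3
    exact h3 hn
  have hwalk : ∀ a b, Relation.ReflTransGen E a b →
      ∃ (n : ℕ) (c : ℕ → α × A), c 0 = a ∧ c n = b ∧ ∀ i < n, E (c i) (c (i + 1)) := by
    intro a b h
    induction h using Relation.ReflTransGen.head_induction_on with
    | refl => exact ⟨0, fun _ => b, rfl, rfl, fun i hi => absurd hi (Nat.not_lt_zero i)⟩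
    | @head a _ h _ ih =>
      obtain ⟨n, c, hc0, hcn, hc⟩ := ih
      refine ⟨n + 1, fun i => Nat.casesOn i a c, rfl, hcn, ?_⟩
      rintro (_ | i) hi
      · subst hc0
        exact h
      · exact hc i (by omega)
  have huniq : ∀ p x y, Relation.ReflTransGen E (p, x) (p, y) → x = y := by
    intro p x y h
    obtain ⟨n, c, h0, hn, hc⟩ := hwalk _ _ h
    have := hclosed n c hc (by rw [h0, hn])
    rw [h0, hn] at this
    exact this.symm
  -- walks over `α` lift to walks in `α × A` with a given starting point
  have hlift : ∀ p q, Relation.ReflTransGen (fun p q => ∃ x y, E (p, x) (q, y)) p q →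
      ∀ x, ∃ y, Relation.ReflTransGen E (p, x) (q, y) := by
    intro p q h x
    induction h with
    | refl => exact ⟨x, .refl⟩
    | tail _ h ih =>
      obtain ⟨y, hy⟩ := ih
      obtain ⟨x', y', hE⟩ := h
      have := htrans _ _ _ _ (y - x') hE
      rw [add_sub_cancel] at this
      exact ⟨_, hy.tail this⟩
  obtain ⟨o⟩ := ‹Nonempty α›
  choose f hf using fun q => hlift o q (hconn o q) 0
  have hE : Std.Symm (Relation.ReflTransGen E) :=
    have : Std.Symm E := ⟨hsymm⟩
    Relation.ReflTransGen.stdSymm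
  refine ⟨fun q => -f q, fun p q x y h => ?_⟩
  have h1 := htrans _ _ _ _ (f p - x) h
  rw [add_sub_cancel] at h1
  have h2 : Relation.ReflTransGen E (q, y + (f p - x)) (q, f q) :=
    (hE.symm _ _ ((hf p).tail h1)).trans (hf q)
  have h3 := huniq _ _ _ h2
  simp only [← h3]
  abel

namespace PlanarIFS

variable {S : PlanarIFS}

/-! ### Symmetries of the fractal -/

lemma bisectorSymmetry_eq {x y : ℂ} (hxy : x ≠ y) (z : ℂ) :
    bisectorSymmetry x y z = (x + y) / 2 - (y - x) / conj (y - x) * conj (z - (x + y) / 2) := by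
  have hd : y - x ≠ 0 := sub_ne_zero.mpr hxy.symm
  have hd' : conj (y - x) ≠ 0 := (map_ne_zero _).mpr hd
  have hmid : midpoint ℝ x y = (x + y) / 2 := by
    rw [midpoint_eq_smul_add, invOf_eq_inv, Complex.real_smul]
    push_cast
    ring
  -- `z` is the foot of its perpendicular on the bisector plus a real multiple of `y - x`.
  set t : ℝ := ((z - (x + y) / 2) * conj (y - x)).re / Complex.normSq (y - x) with ht
  have htc : (t : ℂ) * (y - x) =
      (z - (x + y) / 2 + (y - x) / conj (y - x) * conj (z - (x + y) / 2)) / 2 := by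
    rw [ht, Complex.ofReal_div, Complex.re_eq_add_conj, Complex.normSq_eq_conj_mul_self]
    rw [map_mul, Complex.conj_conj]
    field_simp
  set p : ℂ := z - (t : ℂ) * (y - x) with hp
  have hpm : p ∈ AffineSubspace.perpBisector x y := by
    rw [AffineSubspace.mem_perpBisector_iff_inner_eq_zero, hmid, vsub_eq_sub, vsub_eq_sub,
      Complex.inner, ← Complex.ofReal_inj, Complex.re_eq_add_conj, hp, map_mul, Complex.conj_conj,
      map_sub conj (z - _), map_sub conj z, map_mul, Complex.conj_ofReal]
    have hn : (t : ℂ) * ((y - x) * conj (y - x)) =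
        ((z - (x + y) / 2) * conj (y - x) + (y - x) * conj (z - (x + y) / 2)) / 2 := by
      rw [← mul_assoc, htc]
      field_simp
    rw [map_sub conj z] at hn
    simp only [Complex.ofReal_zero]
    linear_combination -hn
  have hv : (t : ℂ) * (y - x) ∈ (AffineSubspace.perpBisector x y).directionᗮ := by
    rw [AffineSubspace.direction_perpBisector, vsub_eq_sub, ← Complex.real_smul]
    exact Submodule.le_orthogonal_orthogonal _
      (Submodule.smul_mem _ _ (Submodule.mem_span_singleton_self _))
  have hz : z = (t : ℂ) * (y - x) +ᵥ p := by
    rw [vadd_eq_add, hp]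
    ring
  unfold bisectorSymmetry
  conv_lhs => rw [hz]
  rw [EuclideanGeometry.reflection_orthogonal_vadd hpm hv, vadd_eq_add, hp]
  linear_combination -2 * htc

lemma Ψ_injective (S : PlanarIFS) (i : Fin S.N) : Function.Injective (S.Ψ i) := by
  intro x y h
  have := S.L_ne_zero
  simpa [Ψ, div_left_inj' this] using h

lemma Ψ_left_injective (hS : S.IsSimpleNested) {i j : Fin S.N} {z : ℂ}
    (h : S.Ψ i z = S.Ψ j z) : i = j := by
  obtain ⟨U, -, ⟨u, hu⟩, hd, -⟩ := hS.openSet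
  by_contra hij
  have hν : S.ν i = S.ν j := by simpa [Ψ] using h
  have h1 : S.Ψ i u ∈ S.Ψ i '' U ∩ S.Ψ j '' U :=
    ⟨mem_image_of_mem _ hu, ⟨u, hu, by simp [Ψ, hν]⟩⟩
  rw [hd i j hij] at h1
  exact h1

lemma Ψ_mem_K0 (i : Fin S.N) {z : ℂ} (hz : z ∈ S.K0) : S.Ψ i z ∈ S.K0 := by
  rw [S.isGenerated_K0.2.2]
  exact mem_iUnion.mpr ⟨i, z, hz, rfl⟩

lemma exists_Ψ_of_mem_K0 {z : ℂ} (hz : z ∈ S.K0) : ∃ i, ∃ y ∈ S.K0, S.Ψ i y = z := by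
  rw [S.isGenerated_K0.2.2] at hz
  simpa using hz

lemma fixedPts_subset_K0 : S.fixedPts ⊆ S.K0 := by
  rintro x ⟨i, hi⟩
  obtain ⟨hn, hc, -⟩ := S.isGenerated_K0
  obtain ⟨y, hy, hxy⟩ := hc.exists_infDist_eq_dist hn x
  have h1 : dist x y ≤ S.L⁻¹ * dist x y := by
    rw [← hxy, hxy, ← S.dist_Ψ i, hi, ← hxy]
    exact Metric.infDist_le_dist_of_mem (Ψ_mem_K0 i hy)
  have h3 : S.L⁻¹ < 1 := inv_lt_one_of_one_lt₀ S.one_lt_L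
  have h0 : dist x y = 0 := by nlinarith [dist_nonneg (x := x) (y := y)]
  rwa [dist_eq_zero.mp h0]

lemma V_subset_K0 : S.V ⊆ S.K0 := fun _ hx => fixedPts_subset_K0 hx.1

/-- A continuous map that permutes the similitudes of the system by conjugation. -/
def IsSymm (S : PlanarIFS) (T : ℂ → ℂ) : Prop :=
  Continuous T ∧ ∃ σ : Equiv.Perm (Fin S.N), ∀ p z, T (S.Ψ p z) = S.Ψ (σ p) (T z)

lemma IsSymm.comp {T T' : ℂ → ℂ} (h : S.IsSymm T) (h' : S.IsSymm T') : S.IsSymm (T ∘ T') := by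
  obtain ⟨hc, σ, hσ⟩ := h
  obtain ⟨hc', σ', hσ'⟩ := h'
  exact ⟨hc.comp hc', σ'.trans σ, fun p z => by simp [hσ, hσ']⟩

/-- The image of `𝒦^⟨0⟩` under a symmetry is again generated by the system. -/
lemma IsSymm.image_K0 {T : ℂ → ℂ} (h : S.IsSymm T) : T '' S.K0 = S.K0 := by
  obtain ⟨hc, σ, hσ⟩ := h
  obtain ⟨hn, hK, he⟩ := S.isGenerated_K0
  refine S.existsUnique_isGenerated.unique ⟨hn.image _, hK.image hc, ?_⟩ S.isGenerated_K0
  ext z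
  simp only [mem_iUnion, mem_image]
  constructor
  · rintro ⟨y, hy, rfl⟩
    obtain ⟨i, x, hx, rfl⟩ := exists_Ψ_of_mem_K0 hy
    exact ⟨σ i, _, ⟨x, hx, rfl⟩, (hσ i x).symm⟩
  · rintro ⟨i, -, ⟨x, hx, rfl⟩, rfl⟩
    exact ⟨_, Ψ_mem_K0 (σ.symm i) hx, by simp [hσ]⟩

/-! ### Connectedness and cut points -/

/-- `𝒦^⟨0⟩` is connected: a function that is constant on pairs of points of `𝒦^⟨0⟩` at distance
less than `ε` is constant on `𝒦^⟨0⟩`, since by self-similarity and connectedness of the cell graph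
this property passes from `ε` to `ε / L`, and it is clear for large `ε`. -/
lemma isPreconnected_K0 (hS : S.IsSimpleNested) : IsPreconnected S.K0 := by
  obtain ⟨hn, hK, he⟩ := S.isGenerated_K0
  have hV : S.V.Nonempty := by
    rw [← ncard_pos S.finite_V]
    exact lt_of_lt_of_le two_pos hS.two_le_k
  have step : ∀ ε : ℝ,
      (∀ f : ℂ → Prop, (∀ x ∈ S.K0, ∀ y ∈ S.K0, dist x y < ε → (f x ↔ f y)) →
        ∀ x ∈ S.K0, ∀ y ∈ S.K0, (f x ↔ f y)) →
      (∀ f : ℂ → Prop, (∀ x ∈ S.K0, ∀ y ∈ S.K0, dist x y < S.L⁻¹ * ε → (f x ↔ f y)) →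
        ∀ x ∈ S.K0, ∀ y ∈ S.K0, (f x ↔ f y)) := by
    intro ε ih f hf
    have hcell : ∀ i, ∀ x ∈ S.K0, ∀ y ∈ S.K0, (f (S.Ψ i x) ↔ f (S.Ψ i y)) := by
      intro i
      refine ih (fun x => f (S.Ψ i x)) fun x hx y hy hxy => ?_
      refine hf _ (Ψ_mem_K0 i hx) _ (Ψ_mem_K0 i hy) ?_
      rw [S.dist_Ψ]
      exact mul_lt_mul_of_pos_left hxy (inv_pos.mpr S.L_pos)
    have hconst : ∀ a b : S.Vneg1, (f a ↔ f b) := by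
      intro a b
      obtain ⟨w⟩ := hS.connectivity.preconnected a b
      induction w with
      | nil => rfl
      | cons h _ ih' =>
        refine Iff.trans ?_ ih'
        rw [cellGraph, SimpleGraph.fromRel_adj] at h
        rcases h.2 with ⟨i, ⟨x, hx, hxa⟩, ⟨y, hy, hyb⟩⟩ | ⟨i, ⟨x, hx, hxa⟩, ⟨y, hy, hyb⟩⟩
        · rw [← hxa, ← hyb]
          exact hcell i x hx y hy
        · rw [← hxa, ← hyb]
          exact hcell i y hy x hx
    obtain ⟨v, hv⟩ := hV
    intro x' hx' y' hy'
    obtain ⟨i, x, hx, rfl⟩ := exists_Ψ_of_mem_K0 hx'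
    obtain ⟨j, y, hy, rfl⟩ := exists_Ψ_of_mem_K0 hy'
    have h1 := hconst ⟨S.Ψ i v, mem_iUnion.mpr ⟨i, v, hv, rfl⟩⟩
      ⟨S.Ψ j v, mem_iUnion.mpr ⟨j, v, hv, rfl⟩⟩
    exact (hcell i x hx v (V_subset_K0 hv)).trans (h1.trans (hcell j v (V_subset_K0 hv) y hy))
  obtain ⟨D, hD⟩ := hK.isBounded.exists_norm_le
  have hall : ∀ n : ℕ, ∀ f : ℂ → Prop,
      (∀ x ∈ S.K0, ∀ y ∈ S.K0, dist x y < S.L⁻¹ ^ n * (2 * D + 1) → (f x ↔ f y)) →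
        ∀ x ∈ S.K0, ∀ y ∈ S.K0, (f x ↔ f y) := by
    intro n
    induction n with
    | zero =>
      intro f hf x hx y hy
      refine hf x hx y hy ?_
      have := norm_sub_le x y
      rw [dist_eq_norm]
      linarith [hD x hx, hD y hy]
    | succ n ih =>
      have := step _ ih
      simpa only [pow_succ', mul_assoc] using this
  rw [isPreconnected_closed_iff]
  rintro A B hA hB hAB ⟨a, haK, haA⟩ ⟨b, hbK, hbB⟩
  by_contra hne
  have hdisj : Disjoint (S.K0 ∩ A) (S.K0 ∩ B) := by
    rw [Set.disjoint_left]
    intro z hz hz'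
    exact hne ⟨z, hz.1, hz.2, hz'.2⟩
  obtain ⟨δ, hδ, hδ'⟩ := Metric.exists_pos_forall_lt_edist (hK.inter_right hA)
    (hK.isClosed.inter hB) hdisj
  have hD0 : 0 < 2 * D + 1 := by
    linarith [(norm_nonneg a).trans (hD a haK)]
  obtain ⟨n, hn⟩ := exists_pow_lt_of_lt_one (div_pos (NNReal.coe_pos.mpr hδ) hD0)
    (inv_lt_one_of_one_lt₀ S.one_lt_L)
  rw [lt_div_iff₀ hD0] at hn
  have hsep : ∀ x ∈ S.K0 ∩ A, ∀ y ∈ S.K0 ∩ B, ¬ dist x y < S.L⁻¹ ^ n * (2 * D + 1) := by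
    intro x hx y hy hlt
    have h1 := hδ' x hx y hy
    have h2 : dist x y < δ := hlt.trans hn
    rw [edist_nndist, ENNReal.coe_lt_coe] at h1
    rw [← coe_nndist, NNReal.coe_lt_coe] at h2
    exact lt_asymm h1 h2
  have hfin := hall n (fun z => z ∈ A) ?_ a haK b hbK
  · exact hne ⟨b, hbK, hfin.mp haA, hbB⟩
  · intro x hx y hy hxy
    constructor
    · intro h
      by_contra hy'
      exact hsep x ⟨hx, h⟩ y ⟨hy, (hAB hy).resolve_left hy'⟩ hxy
    · intro h
      by_contra hx'
      rw [dist_comm] at hxy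
      exact hsep y ⟨hy, h⟩ x ⟨hx, (hAB hx).resolve_left hx'⟩ hxy

/-- No essential fixed point `x` separates two others, provided the symmetries of `𝒦^⟨0⟩` act
transitively on the essential fixed points. Otherwise choose a separation of `𝒦^⟨0⟩` at some `x`
into closed parts `Q` and `P` with the fewest essential fixed points in `Q`, and move it by a
symmetry to a separation at an essential fixed point `y ≠ x` of `Q`. The essential fixed points
other than `y` in the new part without `x` lie in `Q`, which contradicts minimality as `y` itself is
not counted any more. -/
lemma not_separated (hS : S.IsSimpleNested)
    (hT : ∀ x ∈ S.V, ∀ y ∈ S.V, ∃ T : ℂ ≃ₜ ℂ, T x = y ∧ T '' S.K0 = S.K0 ∧ T '' S.V = S.V)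
    {x : ℂ} (hx : x ∈ S.V) {Q P : Set ℂ} (hQ : IsClosed Q) (hP : IsClosed P)
    (hQP : S.K0 ⊆ Q ∪ P) (hcut : S.K0 ∩ Q ∩ P ⊆ {x})
    {y z : ℂ} (hy : y ∈ S.V) (hyx : y ≠ x) (hyQ : y ∈ Q)
    (hz : z ∈ S.V) (hzx : z ≠ x) (hzP : z ∈ P) : False := by
  induction hn : ((S.V ∩ Q) \ {x}).ncard using Nat.strong_induction_on generalizing x y z Q P with
  | _ n ih =>
  subst hn
  have hconn := isPreconnected_closed_iff.mp (isPreconnected_K0 hS)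
  obtain ⟨T, hTx, hTK, hTV⟩ := hT x hx y hy
  -- `x` lies in both parts, for otherwise they would disconnect `𝒦^⟨0⟩`
  have hxQP : x ∈ Q ∧ x ∈ P := by
    obtain ⟨w, hwK, hwQ, hwP⟩ := hconn Q P hQ hP hQP ⟨y, V_subset_K0 hy, hyQ⟩
      ⟨z, V_subset_K0 hz, hzP⟩
    have : w = x := hcut ⟨⟨hwK, hwQ⟩, hwP⟩
    exact this ▸ ⟨hwQ, hwP⟩
  -- `Q'` and `P'` stand for the parts of the separation at `y`, named such that `x ∈ P'`; then `Q'`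
  -- does not meet `P`, and its essential fixed points other than `y` lie in `Q`
  have key : ∀ Q' P' : Set ℂ, IsClosed Q' → IsClosed P' → S.K0 ⊆ Q' ∪ P' →
      S.K0 ∩ Q' ∩ P' ⊆ {y} → (∃ u ∈ S.V, u ≠ y ∧ u ∈ Q') → (∃ u ∈ S.V, u ≠ y ∧ u ∈ P') →
      x ∈ P' → False := by
    rintro Q' P' hQ' hP' hcov hcut' ⟨u, hu, huy, huQ⟩ ⟨u', hu', huy', huP⟩ hxP'
    have hyP : y ∉ P := fun h => hyx (hcut ⟨⟨V_subset_K0 hy, hyQ⟩, h⟩)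
    have hxQ' : x ∉ Q' := fun h => hyx (hcut' ⟨⟨V_subset_K0 hx, h⟩, hxP'⟩).symm
    have hempty : ∀ w ∈ S.K0, w ∈ P → w ∉ Q' := by
      intro w hw hwP hwQ'
      obtain ⟨v, hv, hv1, hv2P, hv2Q⟩ := hconn (Q ∪ P') (P ∩ Q') (hQ.union hP') (hP.inter hQ')
        (by
          intro v hv
          rcases hQP hv with h | h
          · exact Or.inl (Or.inl h)
          · rcases hcov hv with h' | h'
            · exact Or.inr ⟨h, h'⟩
            · exact Or.inl (Or.inr h'))
        ⟨x, V_subset_K0 hx, Or.inl hxQP.1⟩ ⟨w, hw, hwP, hwQ'⟩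
      rcases hv1 with h | h
      · have : v = x := hcut ⟨⟨hv, h⟩, hv2P⟩
        exact hxQ' (this ▸ hv2Q)
      · have : v = y := hcut' ⟨⟨hv, hv2Q⟩, h⟩
        exact hyP (this ▸ hv2P)
    refine ih _ ?_ hy hQ' hP' hcov hcut' hu huy huQ hu' huy' huP rfl
    refine ncard_lt_ncard ⟨?_, ?_⟩ ((S.finite_V.inter_of_left Q).sdiff)
    · rintro e ⟨⟨heV, heQ'⟩, -⟩
      have heP : e ∉ P := fun h => hempty e (V_subset_K0 heV) h heQ'
      refine ⟨⟨heV, (hQP (V_subset_K0 heV)).resolve_right heP⟩, ?_⟩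
      rintro rfl
      exact heP hxQP.2
    · intro hsub
      exact (hsub ⟨⟨hy, hyQ⟩, hyx⟩).2 rfl
  have hcov : S.K0 ⊆ T '' Q ∪ T '' P := by
    rw [← image_union]
    conv_lhs => rw [← hTK]
    exact image_mono hQP
  have hcut' : S.K0 ∩ T '' Q ∩ T '' P ⊆ {y} := by
    conv_lhs => rw [← hTK]
    rw [← image_inter T.injective, ← image_inter T.injective, ← hTx, ← image_singleton]
    exact image_mono hcut
  have hyQ' : ∃ u ∈ S.V, u ≠ y ∧ u ∈ T '' Q :=
    ⟨T y, hTV ▸ mem_image_of_mem _ hy, fun h => hyx (T.injective (h.trans hTx.symm)),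
      mem_image_of_mem _ hyQ⟩
  have hzP' : ∃ u ∈ S.V, u ≠ y ∧ u ∈ T '' P :=
    ⟨T z, hTV ▸ mem_image_of_mem _ hz, fun h => hzx (T.injective (h.trans hTx.symm)),
      mem_image_of_mem _ hzP⟩
  have hQ' := T.isClosedMap _ hQ
  have hP' := T.isClosedMap _ hP
  rcases hcov (V_subset_K0 hx) with h | h
  · exact key _ _ hP' hQ' (by rwa [union_comm]) (by rwa [inter_right_comm]) hzP' hyQ' h
  · exact key _ _ hQ' hP' hcov hcut' hyQ' hzP' h

/-! ### The regular polygon of essential fixed points -/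

lemma mul_conj_eq_one_of_norm_eq_one {w : ℂ} (h : ‖w‖ = 1) : w * conj w = 1 := by
  rw [Complex.mul_conj, Complex.normSq_eq_norm_sq, h]
  simp

/-- Two distinct circles of radius `1` have at most two common points. -/
lemma eq_zero_of_three_norm_eq_one {a b c τ : ℂ} (ha : ‖a‖ = 1) (hb : ‖b‖ = 1) (hc : ‖c‖ = 1)
    (hab : a ≠ b) (hac : a ≠ c) (hbc : b ≠ c) (ha' : ‖a + τ‖ = 1) (hb' : ‖b + τ‖ = 1)
    (hc' : ‖c + τ‖ = 1) : τ = 0 := by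
  have key : ∀ u : ℂ, ‖u‖ = 1 → ‖u + τ‖ = 1 →
      u ^ 2 * conj τ + τ + u * (τ * conj τ) = 0 := by
    intro u hu hu'
    have h1 := mul_conj_eq_one_of_norm_eq_one hu
    have h2 := mul_conj_eq_one_of_norm_eq_one hu'
    rw [map_add] at h2
    linear_combination u * h2 - (u + τ) * h1
  have h1 := key a ha ha'
  have h2 := key b hb hb'
  have h3 := key c hc hc'
  have h4 : (a + b) * conj τ + τ * conj τ = 0 := by
    apply mul_left_cancel₀ (sub_ne_zero.mpr hab)
    linear_combination h1 - h2
  have h5 : (a + c) * conj τ + τ * conj τ = 0 := by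
    apply mul_left_cancel₀ (sub_ne_zero.mpr hac)
    linear_combination h1 - h3
  have h6 : (b - c) * conj τ = 0 := by linear_combination h4 - h5
  rcases mul_eq_zero.mp h6 with h | h
  · exact absurd (sub_eq_zero.mp h) hbc
  · exact (map_eq_zero _).mp h

/-- A set of `k ≥ 3` unit complex numbers that contains `1` and is stable under the reflections
exchanging two of its elements consists of the `k`-th roots of unity. -/
lemma eq_range_stdAddChar {k : ℕ} [NeZero k] (hk : 3 ≤ k) {H : Set ℂ} (hH : H.ncard = k)
    (h1 : (1 : ℂ) ∈ H) (hn : ∀ w ∈ H, ‖w‖ = 1)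
    (hr : ∀ a ∈ H, ∀ b ∈ H, a ≠ b → ∀ w ∈ H, a * b * conj w ∈ H) :
    H = range (ZMod.stdAddChar (N := k)) := by
  have hfin : H.Finite := finite_of_ncard_pos (by omega)
  -- the product of the reflections for the pairs `(x, y)` and `(1, y)` is multiplication by `x`
  have hmul : ∀ x ∈ H, ∀ w ∈ H, x * w ∈ H := by
    intro x hx w hw
    obtain ⟨y, hy, hy'⟩ : ∃ y ∈ H, y ∉ ({1, x} : Set ℂ) := by
      refine exists_mem_notMem_of_ncard_lt_ncard (lt_of_le_of_lt (ncard_insert_le _ _) ?_)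
        (toFinite _)
      rw [ncard_singleton]
      omega
    simp only [mem_insert_iff, mem_singleton_iff, not_or] at hy'
    have h2 := hr x hx y hy (Ne.symm hy'.2) _ (hr 1 h1 y hy (Ne.symm hy'.1) w hw)
    have h3 := mul_conj_eq_one_of_norm_eq_one (hn y hy)
    simp only [map_mul, map_one, Complex.conj_conj] at h2
    convert h2 using 1
    linear_combination -(x * w) * h3
  have hpow : ∀ x ∈ H, x ^ k = 1 := by
    intro x hx
    have hx0 : x ≠ 0 := by
      rintro rfl
      simpa using hn 0 hx
    have himg : hfin.toFinset.image (fun w => x * w) = hfin.toFinset := by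
      apply Finset.eq_of_subset_of_card_le
      · intro z hz
        simp only [Finset.mem_image, Finite.mem_toFinset] at hz ⊢
        obtain ⟨w, hw, rfl⟩ := hz
        exact hmul x hx w hw
      · rw [Finset.card_image_of_injective _ (mul_right_injective₀ hx0)]
    have hprod : ∏ w ∈ hfin.toFinset, w = x ^ k * ∏ w ∈ hfin.toFinset, w := by
      conv_lhs => rw [← himg]
      rw [Finset.prod_image (fun a _ b _ h => mul_right_injective₀ hx0 h),
        Finset.prod_mul_distrib, Finset.prod_const, ← ncard_eq_toFinset_card H hfin, hH]
    have hne : ∏ w ∈ hfin.toFinset, w ≠ 0 := by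
      rw [Finset.prod_ne_zero_iff]
      intro w hw h0
      rw [Finite.mem_toFinset] at hw
      have := hn w hw
      rw [h0] at this
      simp at this
    exact (mul_eq_right₀ hne).mp hprod.symm
  have hsub : ∀ A : Set ℂ, (∀ x ∈ A, x ^ k = 1) → A.ncard = k →
      A = (Polynomial.nthRootsFinset k (1 : ℂ) : Set ℂ) := by
    intro A hA hcard
    refine eq_of_subset_of_ncard_le ?_ ?_ (toFinite _)
    · intro x hx
      rw [Finset.mem_coe, Polynomial.mem_nthRootsFinset (by omega)]
      exact hA x hx
    · rw [ncard_coe_finset, hcard, Polynomial.nthRootsFinset_def]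
      exact (Multiset.toFinset_card_le _).trans (Polynomial.card_nthRoots _ _)
  rw [hsub H hpow hH, ← hsub (range (ZMod.stdAddChar (N := k)))]
  · rintro _ ⟨s, rfl⟩
    rw [← AddChar.map_nsmul_eq_pow]
    simp
  · rw [← image_univ, ncard_image_of_injective _ ZMod.injective_stdAddChar, ncard_univ,
      Nat.card_eq_fintype_card, ZMod.card]

/-- If `T` is an opposite similarity mapping the vertices of `Ψ_i(𝒦^⟨0⟩)` onto those of
`Ψ_j(𝒦^⟨0⟩)`, it respects their barycenters. -/
lemma map_barycenter {α β : ℂ} (hk : S.k ≠ 0) {T : ℂ → ℂ} (hT : ∀ z, T z = α * conj z + β)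
    (hinj : Function.Injective T) {i j : Fin S.N} (h : T '' (S.Ψ i '' S.V) = S.Ψ j '' S.V) :
    T (S.Ψ i (S.barycenter 0)) = S.Ψ j (S.barycenter 0) := by
  have hk' : (S.k : ℂ) ≠ 0 := Nat.cast_ne_zero.mpr hk
  have hL := S.L_ne_zero
  set W := S.finite_V.toFinset with hW
  have hcard : W.card = S.k := (ncard_eq_toFinset_card S.V S.finite_V).symm
  have hbar : ∑ v ∈ W, v = S.k * S.barycenter 0 := by
    simp only [barycenter, zpow_zero, one_mul]
    field_simp
    rfl
  have himg : W.image (fun v => T (S.Ψ i v)) = W.image (S.Ψ j) := by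
    rw [← Finset.coe_inj, Finset.coe_image, Finset.coe_image, hW, Finite.coe_toFinset, ← h,
      image_image]
  have hsum : ∑ v ∈ W, T (S.Ψ i v) = ∑ v ∈ W, S.Ψ j v := by
    have h1 := Finset.sum_image (f := fun z : ℂ => z) (s := W) (g := fun v => T (S.Ψ i v))
      (fun a _ b _ hab => S.Ψ_injective i (hinj hab))
    have h2 := Finset.sum_image (f := fun z : ℂ => z) (s := W) (g := S.Ψ j)
      (fun a _ b _ hab => S.Ψ_injective j hab)
    rw [← h1, ← h2, himg]
  have hl : ∑ v ∈ W, T (S.Ψ i v) = S.k * T (S.Ψ i (S.barycenter 0)) := by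
    have : ∀ v, T (S.Ψ i v) = α / S.L * conj v + (α * conj (S.ν i) + β) := by
      intro v
      rw [hT, Ψ, map_add, map_div₀, Complex.conj_ofReal]
      ring
    simp only [this]
    rw [Finset.sum_add_distrib, ← Finset.mul_sum, ← map_sum, hbar, Finset.sum_const, hcard,
      map_mul, map_natCast, nsmul_eq_mul]
    ring
  have hr : ∑ v ∈ W, S.Ψ j v = S.k * S.Ψ j (S.barycenter 0) := by
    simp only [Ψ]
    rw [Finset.sum_add_distrib, ← Finset.sum_div, hbar, Finset.sum_const, hcard, nsmul_eq_mul]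
    ring
  rw [hl, hr] at hsum
  exact mul_left_cancel₀ hk' hsum

/-- The essential fixed points are the vertices `g + ρ ω^s`, `s ∈ ℤ/k`, of a regular polygon, and
the reflections that preserve this polygon permute the similitudes. -/
structure IsPolygon (S : PlanarIFS) [NeZero S.k] (g ρ : ℂ) : Prop where
  ne_zero : ρ ≠ 0
  V_eq : S.V = range fun s : ZMod S.k => g + ρ * ZMod.stdAddChar s
  isSymm_refl : ∀ m : ZMod S.k, S.IsSymm fun z => g + ρ * ZMod.stdAddChar m * conj ((z - g) / ρ)

/-- The bisector symmetries have a common fixed point, the mean `c` of the barycenters of all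
cells, so the essential fixed points lie on a circle about `c`. A bisector symmetry maps `V` to a
translate of `V`, which lies on the same circle; as `#V ≥ 3`, it maps `V` to itself. -/
lemma exists_isPolygon (hS : S.IsSimpleNested) [NeZero S.k] (hk3 : 3 ≤ S.k) (hodd : Odd S.k) :
    ∃ g ρ, S.IsPolygon g ρ := by
  have hL := S.L_ne_zero
  have hN : (S.N : ℂ) ≠ 0 := Nat.cast_ne_zero.mpr S.N_pos.ne'
  set c : ℂ := (∑ i, S.Ψ i (S.barycenter 0)) / S.N with hc
  -- `z ↦ c + α * conj (z - c)` is the bisector symmetry of `x` and `y`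
  have hsymm : ∀ x ∈ S.V, ∀ y ∈ S.V, x ≠ y → ∃ α : ℂ, ‖α‖ = 1 ∧ y - c = α * conj (x - c) ∧
      ∃ σ : Equiv.Perm (Fin S.N), ∀ i, ∀ v ∈ S.V, ∃ v' ∈ S.V,
        c + α * conj (S.Ψ i v - c) = S.Ψ (σ i) v' := by
    intro x hx y hy hxy
    have hd : y - x ≠ 0 := sub_ne_zero.mpr hxy.symm
    have hd' : conj (y - x) ≠ 0 := (map_ne_zero _).mpr hd
    set α : ℂ := -((y - x) / conj (y - x)) with hα
    have hα1 : ‖α‖ = 1 := by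
      rw [hα, norm_neg, norm_div, RCLike.norm_conj, div_self (norm_ne_zero_iff.mpr hd)]
    have hα0 : α ≠ 0 := norm_ne_zero_iff.mp (by rw [hα1]; exact one_ne_zero)
    set T := bisectorSymmetry x y with hTdef
    set β : ℂ := (x + y) / 2 - α * conj ((x + y) / 2) with hβ
    have hT : ∀ z, T z = α * conj z + β := by
      intro z
      rw [hTdef, bisectorSymmetry_eq hxy, map_sub conj z, hβ, hα]
      ring
    have hTinj : Function.Injective T := by
      intro a b hab
      rw [hT, hT, add_left_inj] at hab
      exact star_injective (mul_left_cancel₀ hα0 hab)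
    choose f hf using fun i => hS.symmetry i x hx y hy hxy
    have hg : ∀ i, T (S.Ψ i (S.barycenter 0)) = S.Ψ (f i) (S.barycenter 0) :=
      fun i => map_barycenter (by omega) hT hTinj (hf i)
    have hfinj : Function.Injective f := by
      intro i j hij
      have h1 := (hg i).trans ((congrArg (fun l => S.Ψ l (S.barycenter 0)) hij).trans (hg j).symm)
      exact Ψ_left_injective hS (hTinj h1)
    let σ : Equiv.Perm (Fin S.N) := Equiv.ofBijective f (Finite.injective_iff_bijective.mp hfinj)
    have hTc : α * conj c + β = c := by
      have h1 : ∑ i, T (S.Ψ i (S.barycenter 0)) = ∑ i, S.Ψ i (S.barycenter 0) := by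
        rw [Finset.sum_congr rfl fun i _ => hg i]
        exact Equiv.sum_comp σ fun i => S.Ψ i (S.barycenter 0)
      have h2 : ∑ i, S.Ψ i (S.barycenter 0) = S.N * c := by
        rw [hc]
        field_simp
      simp only [hT] at h1
      rw [Finset.sum_add_distrib, ← Finset.mul_sum, ← map_sum, h2, Finset.sum_const,
        Finset.card_univ, Fintype.card_fin, nsmul_eq_mul, map_mul, map_natCast] at h1
      apply mul_left_cancel₀ hN
      linear_combination h1
    have hT' : ∀ z, T z = c + α * conj (z - c) := by
      intro z
      rw [hT, map_sub]
      linear_combination hTc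
    refine ⟨α, hα1, ?_, σ, ?_⟩
    · have : T x = y := by
        rw [hTdef, bisectorSymmetry_eq hxy]
        have h2 : conj (x - (x + y) / 2) = -conj (y - x) / 2 := by
          simp only [map_ofNat, map_sub, map_div₀, map_add]
          ring
        rw [h2]
        field_simp
        ring
      rw [← this, hT']
      ring
    · intro i v hv
      have : T (S.Ψ i v) ∈ S.Ψ (f i) '' S.V := by
        rw [← hf i]
        exact mem_image_of_mem _ (mem_image_of_mem _ hv)
      obtain ⟨v', hv', h⟩ := this
      exact ⟨v', hv', by rw [← hT']; exact h.symm⟩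
  have hVcard : S.V.ncard = S.k := rfl
  obtain ⟨v₀, v₁, -, hv₀, hv₁, -, hv₀₁, -⟩ := (two_lt_ncard_iff S.finite_V).mp
    (show 2 < S.V.ncard by omega)
  have hnorm : ∀ x ∈ S.V, ∀ y ∈ S.V, ‖y - c‖ = ‖x - c‖ := by
    intro x hx y hy
    rcases eq_or_ne x y with rfl | hxy
    · rfl
    · obtain ⟨α, hα, h, -⟩ := hsymm x hx y hy hxy
      rw [h, norm_mul, hα, one_mul, RCLike.norm_conj]
  set ρ : ℂ := v₀ - c with hρ
  have hρ0 : ρ ≠ 0 := by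
    intro h
    have h1 := hnorm v₀ hv₀ v₁ hv₁
    rw [← hρ, h, norm_zero, norm_eq_zero, sub_eq_zero] at h1
    rw [hρ, sub_eq_zero] at h
    exact hv₀₁ (h.trans h1.symm)
  have hρ' : conj ρ ≠ 0 := (map_ne_zero _).mpr hρ0
  set H : Set ℂ := {w | c + ρ * w ∈ S.V} with hH
  have hHn : ∀ w ∈ H, ‖w‖ = 1 := by
    intro w hw
    have h1 := hnorm v₀ hv₀ _ hw
    rw [add_sub_cancel_left, norm_mul, ← hρ] at h1
    exact (mul_eq_left₀ (norm_ne_zero_iff.mpr hρ0)).mp h1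
  have hVH : S.V = (fun w => c + ρ * w) '' H := by
    ext v
    constructor
    · intro hv
      have : c + ρ * ((v - c) / ρ) = v := by
        field_simp
        ring
      exact ⟨(v - c) / ρ, by rw [hH, mem_ofPred_eq, this]; exact hv, this⟩
    · rintro ⟨w, hw, rfl⟩
      exact hw
  have hHcard : H.ncard = S.k := by
    rw [← hVcard, hVH, ncard_image_of_injective]
    intro a b hab
    exact mul_left_cancel₀ hρ0 (add_left_cancel hab)
  -- the symmetry exchanging `c + ρ a` and `c + ρ b` permutes the similitudes and preserves `V`
  have hab : ∀ a ∈ H, ∀ b ∈ H, a ≠ b →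
      ∃ σ : Equiv.Perm (Fin S.N), (∀ p z, c + ρ * (a * b) * conj ((S.Ψ p z - c) / ρ) =
        S.Ψ (σ p) (c + ρ * (a * b) * conj ((z - c) / ρ))) ∧
        ∀ w ∈ H, a * b * conj w ∈ H := by
    intro a ha b hb hne
    obtain ⟨α, hα, hαab, σ, hσ⟩ := hsymm _ ha _ hb
      (fun h => hne (mul_left_cancel₀ hρ0 (add_left_cancel h)))
    have haa := mul_conj_eq_one_of_norm_eq_one (hHn a ha)
    have hαρ : α * conj ρ = ρ * (a * b) := by
      simp only [add_sub_cancel_left, map_mul] at hαab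
      linear_combination -a * hαab - α * conj ρ * haa
    have hform : ∀ z, c + ρ * (a * b) * conj ((z - c) / ρ) = c + α * conj (z - c) := by
      intro z
      rw [← hαρ, map_div₀]
      field_simp
    have habn : ∀ w ∈ H, ‖a * b * conj w‖ = 1 := by
      intro w hw
      rw [norm_mul, norm_mul, RCLike.norm_conj, hHn a ha, hHn b hb, hHn w hw]
      norm_num
    -- up to a translation by `ρ τ / L` the symmetry conjugates `Ψ_p` to `Ψ_(σ p)`, and up to `ρ τ`
    -- it preserves `V`
    have hshift : ∀ p, ∃ τ : ℂ, (∀ z, c + α * conj (S.Ψ p z - c) =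
        S.Ψ (σ p) (c + α * conj (z - c)) + ρ * τ / S.L) ∧
        ∀ w ∈ H, a * b * conj w + τ ∈ H := by
      intro p
      refine ⟨S.L / ρ * (c + α * conj (S.Ψ p c - c) - S.Ψ (σ p) c), ?_, ?_⟩
      · intro z
        simp only [Ψ, map_sub, map_add, map_div₀, Complex.conj_ofReal]
        field_simp
        ring
      · intro w hw
        obtain ⟨v', hv', h⟩ := hσ p _ hw
        rw [hH, mem_ofPred_eq]
        convert hv' using 1
        apply S.Ψ_injective (σ p)
        rw [← h]
        simp only [Ψ, map_sub, map_add, map_div₀, Complex.conj_ofReal, map_mul]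
        field_simp
        linear_combination (-conj w) * hαρ
    -- `V` and its translate lie on the same circle
    have hzero : ∀ τ : ℂ, (∀ w ∈ H, a * b * conj w + τ ∈ H) → τ = 0 := by
      intro τ hτ
      obtain ⟨w₀, w₁, w₂, h₀, h₁, h₂, h₀₁, h₀₂, h₁₂⟩ :=
        (two_lt_ncard_iff (finite_of_ncard_pos (by omega))).mp (show 2 < H.ncard by omega)
      have hab0 : a * b ≠ 0 := by
        have := habn _ ha
        intro h
        rw [h, zero_mul, norm_zero] at this
        exact zero_ne_one this
      have hinj : ∀ {u v : ℂ}, u ≠ v → a * b * conj u ≠ a * b * conj v :=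
        fun huv h => huv (star_injective (mul_left_cancel₀ hab0 h))
      exact eq_zero_of_three_norm_eq_one (habn _ h₀) (habn _ h₁) (habn _ h₂) (hinj h₀₁) (hinj h₀₂)
        (hinj h₁₂) (hHn _ (hτ _ h₀)) (hHn _ (hτ _ h₁)) (hHn _ (hτ _ h₂))
    refine ⟨σ, ?_, ?_⟩
    · intro p z
      obtain ⟨τ, hτ, hτ'⟩ := hshift p
      rw [hform, hform, hτ, hzero τ hτ']
      simp
    · obtain ⟨τ, hτ, hτ'⟩ := hshift ⟨0, S.N_pos⟩
      have := hzero τ hτ'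
      subst this
      simpa using hτ'
  have hHe : H = range (ZMod.stdAddChar (N := S.k)) := by
    refine eq_range_stdAddChar hk3 hHcard ?_ hHn ?_
    · rw [hH, mem_ofPred_eq, hρ]
      simpa using hv₀
    · intro a ha b hb hne
      obtain ⟨-, -, h⟩ := hab a ha b hb hne
      exact h
  refine ⟨c, ρ, hρ0, ?_, ?_⟩
  · rw [hVH, hHe, ← range_comp]
    rfl
  · intro m
    -- as `2` is invertible modulo `k`, `m` is a sum of two distinct residues
    obtain ⟨n, hn⟩ := hodd
    have h2 : 2 * ((n + 1 : ℕ) : ZMod S.k) = 1 := by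
      have : ((2 * n + 1 : ℕ) : ZMod S.k) = 0 := by
        rw [← hn]
        simp
      push_cast at this ⊢
      linear_combination this
    have h1 : (1 : ZMod S.k) ≠ 0 := by
      have : Fact (1 < S.k) := ⟨by omega⟩
      exact one_ne_zero
    set h : ZMod S.k := ((n + 1 : ℕ) : ZMod S.k)
    have hst : h * m + 1 ≠ h * m - 1 := by
      intro heq
      apply h1
      linear_combination (-1 : ZMod S.k) * h2 + h * heq
    obtain ⟨σ, hσ, -⟩ := hab (ZMod.stdAddChar (h * m + 1)) (hHe ▸ mem_range_self _)
      (ZMod.stdAddChar (h * m - 1)) (hHe ▸ mem_range_self _)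
      (fun h => hst (ZMod.injective_stdAddChar h))
    have hm : h * m + 1 + (h * m - 1) = m := by linear_combination m * h2
    rw [← AddChar.map_add_eq_mul, hm] at hσ
    exact ⟨by fun_prop, σ, hσ⟩

/-- The vertex with number `s ∈ ℤ/k` of the regular polygon with center `g` and first vertex
`g + ρ`. -/
noncomputable def vertex (S : PlanarIFS) [NeZero S.k] (g ρ : ℂ) (s : ZMod S.k) : ℂ :=
  g + ρ * ZMod.stdAddChar s

/-- Rotation by `u` steps of the regular polygon with center `g`. -/
noncomputable def turn (S : PlanarIFS) [NeZero S.k] (g : ℂ) (u : ZMod S.k) : ℂ ≃ₜ ℂ where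
  toFun z := g + ZMod.stdAddChar u * (z - g)
  invFun z := g + ZMod.stdAddChar (-u) * (z - g)
  left_inv z := by
    have h : ZMod.stdAddChar (-u) * ZMod.stdAddChar u = (1 : ℂ) := by
      rw [← AddChar.map_add_eq_mul, neg_add_cancel, AddChar.map_zero_eq_one]
    linear_combination (z - g) * h
  right_inv z := by
    have h : ZMod.stdAddChar (-u) * ZMod.stdAddChar u = (1 : ℂ) := by
      rw [← AddChar.map_add_eq_mul, neg_add_cancel, AddChar.map_zero_eq_one]
    linear_combination (z - g) * h
  continuous_toFun := by fun_prop
  continuous_invFun := by fun_prop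

lemma turn_apply [NeZero S.k] (g : ℂ) (u : ZMod S.k) (z : ℂ) :
    S.turn g u z = g + ZMod.stdAddChar u * (z - g) := rfl

lemma turn_vertex [NeZero S.k] (g ρ : ℂ) (u s : ZMod S.k) :
    S.turn g u (S.vertex g ρ s) = S.vertex g ρ (s + u) := by
  rw [turn_apply, vertex, vertex, AddChar.map_add_eq_mul]
  ring

/-! ### Chords and directions in regular polygons -/

lemma stdAddChar_natCast {k : ℕ} [NeZero k] (j : ℕ) :
    ZMod.stdAddChar (j : ZMod k) =
      Complex.exp (((2 * (Real.pi * j / k) : ℝ) : ℂ) * Complex.I) := by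
  have := ZMod.stdAddChar_coe (N := k) j
  rw [Int.cast_natCast] at this
  rw [this]
  push_cast
  congr 1
  ring

lemma re_mul_exp_sub_one (a b : ℝ) :
    ((Complex.exp (((2 * a : ℝ) : ℂ) * Complex.I) - 1) *
      (1 - conj (Complex.exp (((2 * b : ℝ) : ℂ) * Complex.I)))).re =
      -4 * Real.sin a * Real.sin b * Real.cos (b - a) := by
  have ha := Real.sin_sq_add_cos_sq a
  have hb := Real.sin_sq_add_cos_sq b
  simp only [Complex.mul_re, Complex.sub_re, Complex.sub_im, Complex.conj_re, Complex.conj_im,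
    Complex.exp_ofReal_mul_I_re, Complex.exp_ofReal_mul_I_im, Complex.one_re, Complex.one_im]
  rw [Real.cos_two_mul, Real.cos_two_mul, Real.sin_two_mul, Real.sin_two_mul, Real.cos_sub]
  linear_combination (4 - 4 * Real.cos b ^ 2) * ha + 4 * Real.sin a ^ 2 * hb

/-- In a regular polygon with `k = 2n + 1` vertices `ω^j`, the vertex `1` is farthest in the
direction `1 - ω^j` only if `ω^j` is one of the two vertices opposite to it. -/
lemma opposite_of_re_neg {k n j : ℕ} [NeZero k] (hk : k = 2 * n + 1) (hj : 0 < j) (hjk : j < k)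
    (h1 : ((ZMod.stdAddChar (1 : ZMod k) - 1) *
      (1 - conj (ZMod.stdAddChar (j : ZMod k)))).re < 0)
    (h2 : ((ZMod.stdAddChar (-1 : ZMod k) - 1) *
      (1 - conj (ZMod.stdAddChar (j : ZMod k)))).re < 0) : j = n ∨ j = n + 1 := by
  have hk0 : (0 : ℝ) < k := by exact_mod_cast (by omega : 0 < k)
  have hpi := Real.pi_pos
  set a : ℝ := Real.pi * (1 : ℕ) / k with ha
  set b : ℝ := Real.pi * j / k with hb
  have hjR : (j : ℝ) < k := by exact_mod_cast hjk
  have hj0 : (0 : ℝ) < j := by exact_mod_cast hj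
  have hj1 : (1 : ℝ) ≤ j := by exact_mod_cast hj
  have ha0 : 0 < a := by positivity
  have hb0 : 0 < b := by positivity
  have hbpi : b < Real.pi := by
    rw [hb, div_lt_iff₀ hk0]
    exact mul_lt_mul_of_pos_left hjR hpi
  have hab : a ≤ b := by
    rw [ha, hb, Nat.cast_one]
    gcongr
  have hsa : 0 < Real.sin a := Real.sin_pos_of_pos_of_lt_pi ha0 (by linarith)
  have hsb : 0 < Real.sin b := Real.sin_pos_of_pos_of_lt_pi hb0 hbpi
  have hsab : 0 < Real.sin a * Real.sin b := mul_pos hsa hsb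
  have e1 : ZMod.stdAddChar (1 : ZMod k) = Complex.exp (((2 * a : ℝ) : ℂ) * Complex.I) := by
    rw [← stdAddChar_natCast, Nat.cast_one]
  have e2 : ZMod.stdAddChar (-1 : ZMod k) =
      Complex.exp (((2 * (-a) : ℝ) : ℂ) * Complex.I) := by
    rw [AddChar.map_neg_eq_inv, e1, ← Complex.exp_neg]
    push_cast
    ring_nf
  rw [e1, stdAddChar_natCast, re_mul_exp_sub_one] at h1
  rw [e2, stdAddChar_natCast, re_mul_exp_sub_one, Real.sin_neg, sub_neg_eq_add] at h2
  have hc1 : 0 < Real.cos (b - a) := by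
    by_contra hle
    nlinarith [not_lt.mp hle]
  have hc2 : Real.cos (b + a) < 0 := by
    by_contra hle
    nlinarith [not_lt.mp hle]
  have hlt : b - a < Real.pi / 2 := by
    by_contra hle
    linarith [Real.cos_nonpos_of_pi_div_two_le_of_le (not_lt.mp hle) (by linarith)]
  have hgt : Real.pi / 2 < b + a := by
    by_contra hle
    linarith [Real.cos_nonneg_of_neg_pi_div_two_le_of_le (by linarith) (not_lt.mp hle)]
  -- together the two bounds say `k - 2 < 2 j < k + 2`, where `k` is odd
  have h3 : 2 * (j : ℝ) < k + 2 := by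
    have : b - a = (j - 1) * Real.pi / k := by
      rw [ha, hb]
      push_cast
      ring
    rw [this, div_lt_iff₀ hk0] at hlt
    nlinarith
  have h4 : (k : ℝ) < 2 * j + 2 := by
    have : b + a = (j + 1) * Real.pi / k := by
      rw [ha, hb]
      push_cast
      ring
    rw [this, lt_div_iff₀ hk0] at hgt
    nlinarith
  have h3' : 2 * j < k + 2 := by exact_mod_cast h3
  have h4' : k < 2 * j + 2 := by exact_mod_cast h4
  omega

lemma stdAddChar_mul_conj {k : ℕ} [NeZero k] (s : ZMod k) :
    (ZMod.stdAddChar s : ℂ) * conj (ZMod.stdAddChar s) = 1 :=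
  mul_conj_eq_one_of_norm_eq_one (AddChar.norm_apply _ _)

/-- A chord of a regular polygon with an odd number of vertices is determined by its vector:
the only other chord of the circle with the same vector is the image under the central reflection,
whose endpoints are not vertices. -/
lemma chord_unique {k : ℕ} [NeZero k] (hodd : Odd k) {s t s' t' : ZMod k} (hst : s ≠ t)
    (h : (ZMod.stdAddChar s : ℂ) - ZMod.stdAddChar t =
      ZMod.stdAddChar s' - ZMod.stdAddChar t') : s = s' ∧ t = t' := by
  have hs := stdAddChar_mul_conj s
  have ht := stdAddChar_mul_conj t
  have hs' := stdAddChar_mul_conj s'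
  have ht' := stdAddChar_mul_conj t'
  have hc := congrArg (starRingEnd ℂ) h
  simp only [map_sub] at hc
  have hpow : ∀ u : ZMod k, (ZMod.stdAddChar u : ℂ) ^ k = 1 := by
    intro u
    rw [← AddChar.map_nsmul_eq_pow]
    simp
  have hinj : ∀ {u v : ZMod k}, (ZMod.stdAddChar u : ℂ) = ZMod.stdAddChar v → u = v :=
    fun h => ZMod.injective_stdAddChar h
  have hps := hpow s
  have hpt' := hpow t'
  have hst' : (ZMod.stdAddChar s : ℂ) ≠ ZMod.stdAddChar t := fun h => hst (hinj h)
  suffices hs : (ZMod.stdAddChar s : ℂ) = ZMod.stdAddChar s' by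
    refine ⟨hinj hs, hinj ?_⟩
    linear_combination hs - h
  generalize (ZMod.stdAddChar s : ℂ) = a at *
  generalize (ZMod.stdAddChar t : ℂ) = b at *
  generalize (ZMod.stdAddChar s' : ℂ) = c at *
  generalize (ZMod.stdAddChar t' : ℂ) = d at *
  -- `a + d = b + c` and `1/a + 1/d = 1/b + 1/c`
  have key : (a + d) * (a - b) * (a - c) = 0 := by
    have h1 : (a + d) * (b * c) = (b + c) * (a * d) := by
      have : conj a + conj d = conj b + conj c := by linear_combination hc
      linear_combination (a * b * c * d) * this - (b * c * d) * hs + (a * c * d) * ht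
        + (a * b * d) * hs' - (a * b * c) * ht'
    have hd : d = b + c - a := by linear_combination h
    subst hd
    linear_combination h1
  rcases mul_eq_zero.mp key with h1 | h1
  · rcases mul_eq_zero.mp h1 with h2 | h2
    · exfalso
      have : a = -d := eq_neg_of_add_eq_zero_left h2
      rw [this, hodd.neg_pow, hpt'] at hps
      norm_num at hps
    · exact absurd (sub_eq_zero.mp h2) hst'
  · exact sub_eq_zero.mp h1

/-! ### Cells with a common vertex -/

lemma ne_of_linked [NeZero S.k] {g ρ : ℂ} (hS : S.IsSimpleNested) {p q : Fin S.N} {s t : ZMod S.k}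
    (hpq : p ≠ q) (h : S.Ψ p (S.vertex g ρ s) = S.Ψ q (S.vertex g ρ t)) : s ≠ t := by
  rintro rfl
  exact hpq (Ψ_left_injective hS h)

namespace IsPolygon

variable [NeZero S.k] {g ρ : ℂ}

lemma vertex_mem_V (hP : S.IsPolygon g ρ) (s : ZMod S.k) : S.vertex g ρ s ∈ S.V := by
  rw [hP.V_eq]
  exact mem_range_self s

lemma exists_vertex (hP : S.IsPolygon g ρ) {v : ℂ} (hv : v ∈ S.V) :
    ∃ s, v = S.vertex g ρ s := by
  rw [hP.V_eq] at hv
  obtain ⟨s, rfl⟩ := hv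
  exact ⟨s, rfl⟩

lemma vertex_mem_K0 (hP : S.IsPolygon g ρ) (s : ZMod S.k) : S.vertex g ρ s ∈ S.K0 :=
  V_subset_K0 (hP.vertex_mem_V s)

lemma vertex_injective (hP : S.IsPolygon g ρ) : Function.Injective (S.vertex g ρ) := fun _ _ h =>
  ZMod.injective_stdAddChar (mul_left_cancel₀ hP.ne_zero (add_left_cancel h))

lemma barycenter_eq (hP : S.IsPolygon g ρ) (hk : 2 ≤ S.k) (M : ℤ) :
    S.barycenter M = (S.L : ℂ) ^ M * g := by
  have hk0 : (S.k : ℂ) ≠ 0 := Nat.cast_ne_zero.mpr (by omega)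
  have hV : S.finite_V.toFinset = Finset.univ.image (S.vertex g ρ) := by
    rw [← Finset.coe_inj, Finite.coe_toFinset, Finset.coe_image, Finset.coe_univ, image_univ,
      hP.V_eq]
    rfl
  have hsum : ∑ s : ZMod S.k, (ZMod.stdAddChar s : ℂ) = 0 := by
    apply AddChar.sum_eq_zero_of_ne_one
    intro h
    have : Fact (1 < S.k) := ⟨by omega⟩
    refine one_ne_zero (α := ZMod S.k) (ZMod.injective_stdAddChar (N := S.k) ?_)
    rw [h]
    simp
  rw [barycenter, hV, Finset.sum_image (fun a _ b _ h => hP.vertex_injective h),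
    ← Finset.mul_sum]
  simp only [vertex]
  rw [Finset.sum_add_distrib, ← Finset.mul_sum, hsum, Finset.sum_const, Finset.card_univ,
    ZMod.card, nsmul_eq_mul]
  field_simp
  ring

/-- A rotation of the polygon is a product of two of its reflections. -/
lemma isSymm_turn (hP : S.IsPolygon g ρ) (u : ZMod S.k) : S.IsSymm (S.turn g u) := by
  have h := (hP.isSymm_refl u).comp (hP.isSymm_refl 0)
  have hρ := hP.ne_zero
  convert h using 1
  funext z
  simp only [turn_apply, Function.comp_apply, AddChar.map_zero_eq_one, mul_one,
    add_sub_cancel_left]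
  rw [mul_div_cancel_left₀ _ hρ, Complex.conj_conj]
  field_simp

lemma turn_image_K0 (hP : S.IsPolygon g ρ) (u : ZMod S.k) : S.turn g u '' S.K0 = S.K0 :=
  (hP.isSymm_turn u).image_K0

lemma exists_turn (hP : S.IsPolygon g ρ) {x y : ℂ} (hx : x ∈ S.V) (hy : y ∈ S.V) :
    ∃ T : ℂ ≃ₜ ℂ, T x = y ∧ T '' S.K0 = S.K0 ∧ T '' S.V = S.V := by
  obtain ⟨s, rfl⟩ := hP.exists_vertex hx
  obtain ⟨t, rfl⟩ := hP.exists_vertex hy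
  refine ⟨S.turn g (t - s), ?_, hP.turn_image_K0 _, ?_⟩
  · rw [turn_vertex, add_sub_cancel]
  · ext z
    constructor
    · rintro ⟨v, hv, rfl⟩
      obtain ⟨u, rfl⟩ := hP.exists_vertex hv
      rw [turn_vertex]
      exact hP.vertex_mem_V _
    · intro hz
      obtain ⟨u, rfl⟩ := hP.exists_vertex hz
      exact ⟨_, hP.vertex_mem_V (u - (t - s)), by rw [turn_vertex, sub_add_cancel]⟩

/-- Two distinct cells have at most one common vertex. -/
lemma linked_unique (hP : S.IsPolygon g ρ) (hS : S.IsSimpleNested) (hodd : Odd S.k) {p q : Fin S.N}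
    {s t s' t' : ZMod S.k} (hpq : p ≠ q)
    (h : S.Ψ p (S.vertex g ρ s) = S.Ψ q (S.vertex g ρ t))
    (h' : S.Ψ p (S.vertex g ρ s') = S.Ψ q (S.vertex g ρ t')) : s = s' ∧ t = t' := by
  refine chord_unique hodd (ne_of_linked hS hpq h) ?_
  have hL := S.L_ne_zero
  simp only [Ψ, vertex] at h h'
  apply mul_left_cancel₀ (div_ne_zero hP.ne_zero hL)
  linear_combination h - h'

/-- Points of `𝒦^⟨0⟩` common to two cells are vertices. -/
lemma exists_linked_of_eq (hP : S.IsPolygon g ρ) (hS : S.IsSimpleNested) {p q : Fin S.N}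
    {y z : ℂ} (hpq : p ≠ q) (hy : y ∈ S.K0) (hz : z ∈ S.K0) (h : S.Ψ p y = S.Ψ q z) :
    ∃ s t, y = S.vertex g ρ s ∧ z = S.vertex g ρ t := by
  have hmem : S.Ψ p y ∈ S.Ψ p '' S.V ∩ S.Ψ q '' S.V := by
    rw [← hS.nesting p q hpq]
    exact ⟨mem_image_of_mem _ hy, ⟨z, hz, h.symm⟩⟩
  obtain ⟨⟨v, hv, hv'⟩, ⟨w, hw, hw'⟩⟩ := hmem
  rw [h] at hw'
  rw [S.Ψ_injective p hv'] at hv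
  rw [S.Ψ_injective q hw'] at hw
  obtain ⟨s, hs⟩ := hP.exists_vertex hv
  obtain ⟨t, ht⟩ := hP.exists_vertex hw
  exact ⟨s, t, hs, ht⟩

/-- If two cells share the vertices number `s` and `t`, these are opposite vertices. The two cells
are exchanged by the reflection in the line through the common vertex perpendicular to the segment
joining their centers, so by nesting this line meets each cell only in the common vertex. As this
vertex does not separate two other vertices, no vertex of a cell lies on the far side of the
line. -/
lemma opposite_of_linked (hP : S.IsPolygon g ρ) (hS : S.IsSimpleNested) {n : ℕ}
    (hk : S.k = 2 * n + 1) {p q : Fin S.N} {s t : ZMod S.k} (hpq : p ≠ q)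
    (h : S.Ψ p (S.vertex g ρ s) = S.Ψ q (S.vertex g ρ t)) :
    t - s = (n : ZMod S.k) ∨ t - s = ((n + 1 : ℕ) : ZMod S.k) := by
  have hst := ne_of_linked hS hpq h
  have hodd : Odd S.k := ⟨n, hk⟩
  have hL := S.L_ne_zero
  have hρ := hP.ne_zero
  have hρ' : conj ρ ≠ 0 := (map_ne_zero _).mpr hρ
  have hes := stdAddChar_mul_conj s
  have het := stdAddChar_mul_conj t
  set d : ℂ := S.vertex g ρ s - S.vertex g ρ t with hd
  -- the height above the line through the common vertex
  let f : ℂ → ℝ := fun z => ((z - S.vertex g ρ s) * conj d).re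
  have hf : Continuous f := by fun_prop
  -- on the line, the symmetry exchanging the vertices number `s` and `t` is the translation by `-d`,
  -- which is the difference of the two cells in the scale of `𝒦^⟨0⟩`
  have hline : ∀ z ∈ S.K0, f z = 0 → z = S.vertex g ρ s := by
    intro z hz hfz
    set z' : ℂ := g + ρ * ZMod.stdAddChar (s + t) * conj ((z - g) / ρ) with hz'
    have hz'K : z' ∈ S.K0 := by
      rw [← (hP.isSymm_refl (s + t)).image_K0]
      exact mem_image_of_mem _ hz
    have hzz' : z - z' = d := by
      have h0 : (z - S.vertex g ρ s) * conj d + conj (z - S.vertex g ρ s) * d = 0 := by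
        have := Complex.re_eq_add_conj ((z - S.vertex g ρ s) * conj d)
        rw [show ((z - S.vertex g ρ s) * conj d).re = 0 from hfz, map_mul,
          Complex.conj_conj] at this
        simp only [Complex.ofReal_zero] at this
        linear_combination -2 * this
      have hd0 : conj d ≠ 0 := by
        rw [map_ne_zero, hd, sub_ne_zero]
        exact fun h => hst (hP.vertex_injective h)
      apply mul_right_cancel₀ hd0
      rw [hz', map_div₀, AddChar.map_add_eq_mul]
      rw [hd] at h0 ⊢
      simp only [vertex, map_sub, map_add, map_mul] at h0 ⊢
      generalize (ZMod.stdAddChar s : ℂ) = a at *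
      generalize (ZMod.stdAddChar t : ℂ) = b at *
      set Q : ℂ := (conj z - conj g) / conj ρ
      have hQ : Q * conj ρ = conj z - conj g := div_mul_cancel₀ _ hρ'
      linear_combination h0 - ρ * Q * conj ρ * (b * hes - a * het) + ρ * (a - b) * hQ +
        ρ * conj ρ * (hes - het)
    have hlink : S.Ψ p z = S.Ψ q z' := by
      simp only [Ψ] at h ⊢
      rw [hd] at hzz'
      linear_combination (1 / (S.L : ℂ)) * hzz' + h
    obtain ⟨s', t', hs', ht'⟩ := hP.exists_linked_of_eq hS hpq hz hz'K hlink
    rw [hs', ht'] at hlink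
    rw [hs', (hP.linked_unique hS hodd hpq h hlink).1]
  -- the vertex number `t` is on the near side of the line
  have hneg : ∀ u, u ≠ s → f (S.vertex g ρ u) < 0 := by
    intro u hu
    by_contra hle
    refine not_separated hS (fun x hx y hy => hP.exists_turn hx hy) (hP.vertex_mem_V s)
      (isClosed_le continuous_const hf) (isClosed_le hf continuous_const)
      (fun z _ => le_total 0 (f z)) ?_ (hP.vertex_mem_V u)
      (fun h => hu (hP.vertex_injective h)) (not_lt.mp hle) (hP.vertex_mem_V t)
      (fun h => hst (hP.vertex_injective h).symm) ?_
    · rintro z ⟨⟨hz, h1⟩, h2⟩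
      exact hline z hz (le_antisymm h2 h1)
    · have : (S.vertex g ρ t - S.vertex g ρ s) * conj d = -((Complex.normSq d : ℝ) : ℂ) := by
        rw [← Complex.mul_conj, hd]
        ring
      show ((S.vertex g ρ t - S.vertex g ρ s) * conj d).re ≤ 0
      rw [this, Complex.neg_re, Complex.ofReal_re]
      exact neg_nonpos.mpr (Complex.normSq_nonneg d)
  have hre : ∀ u : ZMod S.k, u ≠ 0 → ((ZMod.stdAddChar u - 1) *
      (1 - conj (ZMod.stdAddChar (t - s)))).re < 0 := by
    intro u hu
    have h1 := hneg (s + u) (by simpa using hu)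
    have h2 : (S.vertex g ρ (s + u) - S.vertex g ρ s) * conj d =
        ((Complex.normSq ρ : ℝ) : ℂ) * ((ZMod.stdAddChar u - 1) *
      (1 - conj (ZMod.stdAddChar (t - s)))) := by
      have h3 : (ZMod.stdAddChar t : ℂ) = ZMod.stdAddChar s * ZMod.stdAddChar (t - s) := by
        rw [← AddChar.map_add_eq_mul, add_sub_cancel]
      rw [← Complex.mul_conj, hd]
      simp only [vertex, map_sub, map_add, map_mul, h3, AddChar.map_add_eq_mul]
      linear_combination (ρ * conj ρ * (ZMod.stdAddChar u - 1) *
        (1 - conj (ZMod.stdAddChar (t - s)))) * hes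
    have h1' : ((S.vertex g ρ (s + u) - S.vertex g ρ s) * conj d).re < 0 := h1
    rw [h2, Complex.re_ofReal_mul] at h1'
    exact (pos_iff_neg_of_mul_neg h1').mp (Complex.normSq_pos.mpr hρ)
  have h10 : (1 : ZMod S.k) ≠ 0 := by
    intro h10
    exact hst (by rw [← mul_one s, ← mul_one t, h10, mul_zero, mul_zero])
  have hval : ((t - s).val : ZMod S.k) = t - s := ZMod.natCast_zmod_val _
  have hpos : 0 < (t - s).val := by
    rw [Nat.pos_iff_ne_zero, Ne, ZMod.val_eq_zero, sub_eq_zero]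
    exact hst.symm
  have h1 := hre 1 h10
  have h2 := hre (-1) (neg_ne_zero.mpr h10)
  rw [← hval] at h1 h2
  rcases opposite_of_re_neg hk hpos (ZMod.val_lt _) h1 h2 with h | h
  · exact Or.inl (by rw [← hval, h])
  · exact Or.inr (by rw [← hval, h])

end IsPolygon

/-! ### Complexes and their translation vectors -/

/-- The translation vector `∑_{j=1}^m L^j ν_{w(j-1)}` of a `0`-complex in `𝒦^⟨m⟩`. -/
noncomputable def shift (S : PlanarIFS) (w : ℕ → Fin S.N) (m : ℕ) : ℂ :=
  ∑ j ∈ Finset.range m, (S.L : ℂ) ^ (j + 1) * S.ν (w j)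

lemma shift_succ (w : ℕ → Fin S.N) (m : ℕ) :
    S.shift w (m + 1) = S.shift w m + (S.L : ℂ) ^ (m + 1) * S.ν (w m) :=
  Finset.sum_range_succ _ _

lemma complexSet_zero (a : ℂ) : S.complexSet 0 a = (fun z => z + a) '' S.K0 := by
  simp [complexSet, K]

lemma vertices_zero (a : ℂ) : S.vertices 0 a = (fun z => z + a) '' S.V := by
  simp [vertices, VM]

lemma mul_Ψ (i : Fin S.N) (c z : ℂ) :
    c * (S.L : ℂ) * S.Ψ i z = c * z + c * (S.L : ℂ) * S.ν i := by
  have := S.L_ne_zero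
  rw [Ψ]
  field_simp

/-- The part of `𝒦^⟨m⟩` with translation vector `shift w m`, in coordinates scaled to `𝒦^⟨0⟩`. -/
lemma exists_add_shift_eq (w : ℕ → Fin S.N) (m : ℕ) {z : ℂ} (hz : z ∈ S.K0) :
    ∃ y ∈ S.K0, z + S.shift w m = (S.L : ℂ) ^ m * y := by
  induction m with
  | zero => exact ⟨z, hz, by simp [shift]⟩
  | succ m ih =>
    obtain ⟨y, hy, h⟩ := ih
    refine ⟨S.Ψ (w m) y, Ψ_mem_K0 _ hy, ?_⟩
    rw [shift_succ, ← add_assoc, h, pow_succ, mul_Ψ]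

/-- Distinct `0`-complexes have only finitely many common points. -/
lemma shift_eq_of_infinite (hS : S.IsSimpleNested) (w w' : ℕ → Fin S.N) (m : ℕ)
    (h : ((fun z => z + S.shift w m) '' S.K0 ∩ (fun z => z + S.shift w' m) '' S.K0).Infinite) :
    S.shift w m = S.shift w' m := by
  induction m with
  | zero => simp [shift]
  | succ m ih =>
    by_cases hw : w m = w' m
    · rw [shift_succ, shift_succ, hw, ih]
      refine Infinite.of_image (fun z => z + (S.L : ℂ) ^ (m + 1) * S.ν (w m)) (h.mono ?_)
      rintro _ ⟨⟨y, hy, rfl⟩, ⟨z, hz, hzy⟩⟩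
      simp only [shift_succ] at hzy ⊢
      refine ⟨y + S.shift w m, ⟨⟨y, hy, rfl⟩, ⟨z, hz, ?_⟩⟩, by simp only; ring⟩
      rw [← hw] at hzy
      simp only
      linear_combination hzy
    · exfalso
      have hL := pow_ne_zero (m + 1) S.L_ne_zero
      refine h ((((S.finite_V.image (S.Ψ (w m))).inter_of_left
        (S.Ψ (w' m) '' S.V)).image fun z => (S.L : ℂ) ^ (m + 1) * z).subset ?_)
      rw [← hS.nesting _ _ hw]
      rintro _ ⟨⟨y, hy, rfl⟩, ⟨z, hz, hzy⟩⟩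
      obtain ⟨y', hy', hyy'⟩ := exists_add_shift_eq w m hy
      obtain ⟨z', hz', hzz'⟩ := exists_add_shift_eq w' m hz
      have h1 : y + S.shift w (m + 1) = (S.L : ℂ) ^ (m + 1) * S.Ψ (w m) y' := by
        rw [shift_succ, ← add_assoc, hyy', pow_succ, mul_Ψ]
      have h2 : z + S.shift w' (m + 1) = (S.L : ℂ) ^ (m + 1) * S.Ψ (w' m) z' := by
        rw [shift_succ, ← add_assoc, hzz', pow_succ, mul_Ψ]
      simp only at hzy ⊢
      refine ⟨_, ⟨⟨y', hy', rfl⟩, ⟨z', hz', ?_⟩⟩, h1.symm⟩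
      apply mul_left_cancel₀ hL
      rw [← h1, ← h2, hzy]

lemma exists_shift_of_isComplexShift {a : ℂ} (ha : S.IsComplexShift 0 a) :
    ∃ w m, 0 < m ∧ a = S.shift w m := by
  obtain ⟨-, J, hJ, w, rfl⟩ := ha
  obtain ⟨m, rfl⟩ : ∃ m : ℕ, J = m := ⟨J.toNat, by omega⟩
  refine ⟨fun j => w (j + 1), m, by omega, ?_⟩
  symm
  refine Finset.sum_bij (fun j _ => (j : ℤ) + 1) ?_ ?_ ?_ ?_
  · intro j hj
    rw [Finset.mem_range] at hj
    rw [Finset.mem_Icc]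
    omega
  · intro j _ j' _ h
    omega
  · intro b hb
    rw [Finset.mem_Icc] at hb
    exact ⟨(b - 1).toNat, by rw [Finset.mem_range]; omega, by omega⟩
  · intro j _
    norm_cast

/-- Padding with an index `o` such that `ν_o = 0`. -/
lemma shift_pad {o : Fin S.N} (ho : S.ν o = 0) (w : ℕ → Fin S.N) {m n : ℕ} (hmn : m ≤ n) :
    S.shift (fun j => if j < m then w j else o) n = S.shift w m := by
  unfold shift
  rw [← Finset.sum_range_add_sum_Ico _ hmn]
  have h1 : ∑ j ∈ Finset.Ico m n, (S.L : ℂ) ^ (j + 1) * S.ν (if j < m then w j else o) = 0 := by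
    refine Finset.sum_eq_zero fun j hj => ?_
    rw [if_neg (not_lt.mpr (Finset.mem_Ico.mp hj).1), ho, mul_zero]
  rw [h1, add_zero]
  refine Finset.sum_congr rfl fun j hj => ?_
  simp only
  rw [if_pos (Finset.mem_range.mp hj)]

lemma K_subset_K {o : Fin S.N} (ho : S.ν o = 0) {M M' : ℤ} (h : M ≤ M') : S.K M ⊆ S.K M' := by
  induction M', h using Int.leInduction with
  | base => exact subset_rfl
  | succ n _ ih =>
    refine ih.trans ?_
    rintro _ ⟨z, hz, rfl⟩
    refine ⟨S.Ψ o z, Ψ_mem_K0 o hz, ?_⟩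
    simp only
    rw [zpow_add₀ S.L_ne_zero, zpow_one, mul_Ψ, ho, mul_zero, add_zero]

lemma K_subset_Kinf {o : Fin S.N} (ho : S.ν o = 0) (M : ℤ) : S.K M ⊆ S.Kinf :=
  (K_subset_K ho (Int.self_le_toNat M)).trans
    (subset_iUnion (fun m : ℕ => S.K m) M.toNat)

lemma complexSet_subset_K (M : ℤ) (p : Fin S.N) :
    S.complexSet M ((S.L : ℂ) ^ (M + 1) * S.ν p) ⊆ S.K (M + 1) := by
  rintro _ ⟨_, ⟨z, hz, rfl⟩, rfl⟩
  refine ⟨S.Ψ p z, Ψ_mem_K0 p hz, ?_⟩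
  simp only
  rw [zpow_add₀ S.L_ne_zero, zpow_one, mul_Ψ]

lemma isComplexShift_cell {o : Fin S.N} (ho : S.ν o = 0) (M : ℤ) (p : Fin S.N) :
    S.IsComplexShift M ((S.L : ℂ) ^ (M + 1) * S.ν p) :=
  ⟨(complexSet_subset_K M p).trans (K_subset_Kinf ho _), M + 1, le_rfl, fun _ => p, by simp⟩

lemma isInnerComplex_cell {o : Fin S.N} (ho : S.ν o = 0) (p : Fin S.N) :
    S.IsInnerComplex ((S.L : ℂ) * S.ν p) := by
  have h1 := isComplexShift_cell ho 0 p
  have h2 := S.complexSet_subset_K 0 p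
  rw [zero_add, zpow_one] at h1 h2
  exact ⟨h1, h2⟩

/-- The `0`-complexes in `𝒦^⟨1⟩` are `L Ψ_p(𝒦^⟨0⟩)`: an infinite set covered by finitely many of
these has infinitely many points in one of them. -/
lemma exists_cell_of_isInnerComplex (hS : S.IsSimpleNested) {o : Fin S.N} (ho : S.ν o = 0)
    {a : ℂ} (ha : S.IsInnerComplex a) : ∃ p, a = (S.L : ℂ) * S.ν p := by
  have hinf : S.K0.Infinite := by
    refine (isPreconnected_K0 hS).infinite_of_nontrivial ?_
    refine Set.Nontrivial.mono ?_ V_subset_K0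
    have := S.finite_V.to_subtype
    rw [← one_lt_ncard_iff_nontrivial]
    exact hS.two_le_k
  obtain ⟨w, m, hm, rfl⟩ := exists_shift_of_isComplexShift ha.1
  have hcov : S.complexSet 0 (S.shift w m) ⊆
      ⋃ p, S.complexSet 0 (S.shift w m) ∩ S.complexSet 0 ((S.L : ℂ) * S.ν p) := by
    intro z hz
    obtain ⟨y, hy, rfl⟩ := ha.2 hz
    obtain ⟨p, x, hx, rfl⟩ := exists_Ψ_of_mem_K0 hy
    refine mem_iUnion.mpr ⟨p, hz, ?_⟩
    rw [complexSet_zero]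
    refine ⟨x, hx, ?_⟩
    have := mul_Ψ p 1 x
    simp only [one_mul] at this
    simp only [zpow_one, this]
  by_contra hne
  push Not at hne
  have hfin : (S.complexSet 0 (S.shift w m)).Finite := by
    refine Finite.subset (finite_iUnion fun p => ?_) hcov
    by_contra hI
    apply hne p
    have hp : (S.L : ℂ) * S.ν p = S.shift (fun j => if j < 1 then p else o) m := by
      rw [shift_pad ho (fun _ => p) (by omega : 1 ≤ m)]
      simp [shift]
    rw [hp]
    refine shift_eq_of_infinite hS _ _ m ?_
    rw [← complexSet_zero, ← complexSet_zero, ← hp]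
    exact hI
  rw [complexSet_zero] at hfin
  exact hinf (hfin.of_finite_image (add_left_injective _).injOn)

/-! ### Rotations in cycles -/

lemma linked_iff {p q : Fin S.N} {x y : ℂ} :
    S.Ψ p x = S.Ψ q y ↔ x + (S.L : ℂ) * S.ν p = y + (S.L : ℂ) * S.ν q := by
  have hL := S.L_ne_zero
  have h1 := mul_Ψ p 1 x
  have h2 := mul_Ψ q 1 y
  simp only [one_mul] at h1 h2
  rw [← h1, ← h2]
  exact ⟨fun h => by rw [h], fun h => mul_left_cancel₀ hL h⟩

variable [NeZero S.k] {g ρ : ℂ}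

/-- Adjacent complexes whose common vertex has the numbers `s` and `t` arise from each other by
`t - s` steps of rotation about this vertex. -/
lemma arisesByRotation_iff (hP : S.IsPolygon g ρ) {θ : ℝ} {u : ZMod S.k}
    (hθ : Complex.exp (θ * Complex.I) = ZMod.stdAddChar u) (p q : Fin S.N) :
    S.ArisesByRotation θ ((S.L : ℂ) * S.ν p) ((S.L : ℂ) * S.ν q) ↔
      ∃ s t, S.Ψ p (S.vertex g ρ s) = S.Ψ q (S.vertex g ρ t) ∧ t - s = u := by
  have key : ∀ (s : ZMod S.k) (v : ℂ), v = S.vertex g ρ s + (S.L : ℂ) * S.ν p →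
      rot v θ '' S.complexSet 0 ((S.L : ℂ) * S.ν p) =
        S.complexSet 0 (v - S.vertex g ρ (s + u)) := by
    rintro s v rfl
    rw [complexSet_zero, complexSet_zero]
    conv_rhs => rw [← hP.turn_image_K0 u]
    rw [image_image, image_image]
    refine image_congr fun z _ => ?_
    rw [rot, hθ, turn_apply, vertex, vertex, AddChar.map_add_eq_mul]
    ring
  constructor
  · rintro ⟨v, ⟨h1, h2⟩, himg⟩
    rw [vertices_zero] at h1 h2
    obtain ⟨x, hx, hxv⟩ := h1
    obtain ⟨y, hy, hyv⟩ := h2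
    obtain ⟨s, rfl⟩ := hP.exists_vertex hx
    obtain ⟨t, rfl⟩ := hP.exists_vertex hy
    refine ⟨s, t, linked_iff.mpr (hxv.trans hyv.symm), ?_⟩
    rw [key s v hxv.symm] at himg
    have h3 := S.complexSet_injective 0 himg
    have h4 : S.vertex g ρ t = S.vertex g ρ (s + u) := by
      simp only at hyv
      linear_combination hyv + h3
    rw [hP.vertex_injective h4]
    ring
  · rintro ⟨s, t, h, rfl⟩
    have h' := linked_iff.mp h
    refine ⟨S.vertex g ρ s + (S.L : ℂ) * S.ν p, ⟨?_, ?_⟩, ?_⟩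
    · rw [vertices_zero]
      exact ⟨_, hP.vertex_mem_V s, rfl⟩
    · rw [vertices_zero, h']
      exact ⟨_, hP.vertex_mem_V t, rfl⟩
    · rw [key s _ rfl, h', add_sub_cancel, add_sub_cancel_left]

/-- The steps of a cycle of `0`-complexes in `𝒦^⟨1⟩` add up to `(n + 1) (c - d)` modulo
`k = 2n + 1`, because `n ≡ -(n + 1)`. -/
lemma sum_steps_eq (hS : S.IsSimpleNested) (hP : S.IsPolygon g ρ) {n : ℕ} (hk : S.k = 2 * n + 1)
    {m : ℕ} [NeZero m] (c : Fin m → Fin S.N) (s t : Fin m → ZMod S.k)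
    (hne : ∀ i, c i ≠ c (i + 1))
    (hl : ∀ i, S.Ψ (c i) (S.vertex g ρ (s i)) = S.Ψ (c (i + 1)) (S.vertex g ρ (t i))) :
    ∑ i, (t i - s i) = ((n + 1 : ℕ) : ZMod S.k) *
      (((S.rotationCount (((S.k : ℝ) + 1) / S.k * Real.pi) fun i => (S.L : ℂ) * S.ν (c i) : ℤ) -
        (S.rotationCount (((S.k : ℝ) - 1) / S.k * Real.pi) fun i => (S.L : ℂ) * S.ν (c i) : ℤ) :
          ℤ) : ZMod S.k) := by
  have hodd : Odd S.k := ⟨n, hk⟩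
  have hk0 : (S.k : ℝ) ≠ 0 := Nat.cast_ne_zero.mpr (NeZero.ne _)
  have hkR : (S.k : ℝ) = 2 * n + 1 := by exact_mod_cast hk
  have hkZ : (2 : ZMod S.k) * n + 1 = 0 := by
    have : ((2 * n + 1 : ℕ) : ZMod S.k) = 0 := by
      rw [← hk]
      simp
    exact_mod_cast this
  have count : ∀ (θ : ℝ) (u : ZMod S.k), Complex.exp (θ * Complex.I) = ZMod.stdAddChar u →
      S.rotationCount θ (fun i => (S.L : ℂ) * S.ν (c i)) =
        (Finset.univ.filter fun i => t i - s i = u).card := by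
    intro θ u hθ
    have hset : {i | S.ArisesByRotation θ ((S.L : ℂ) * S.ν (c i)) ((S.L : ℂ) * S.ν (c (i + 1)))} =
        {i | t i - s i = u} := by
      ext i
      simp only [mem_ofPred_eq]
      rw [arisesByRotation_iff hP hθ]
      constructor
      · rintro ⟨s', t', h, hu⟩
        obtain ⟨h1, h2⟩ := hP.linked_unique hS hodd (hne i) (hl i) h
        rw [h1, h2, hu]
      · intro h
        exact ⟨_, _, hl i, h⟩
    rw [rotationCount, hset, ncard_eq_toFinset_card', toFinset_ofPred]
  have hp : S.rotationCount (((S.k : ℝ) + 1) / S.k * Real.pi) (fun i => (S.L : ℂ) * S.ν (c i)) =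
      (Finset.univ.filter fun i => t i - s i = ((n + 1 : ℕ) : ZMod S.k)).card := by
    apply count
    rw [stdAddChar_natCast]
    congr 3
    rw [hkR]
    push_cast
    ring
  have hm : S.rotationCount (((S.k : ℝ) - 1) / S.k * Real.pi) (fun i => (S.L : ℂ) * S.ν (c i)) =
      (Finset.univ.filter fun i => t i - s i = (n : ZMod S.k)).card := by
    apply count
    rw [stdAddChar_natCast]
    congr 3
    rw [hkR]
    ring
  rw [hp, hm]
  have hne' : (n : ZMod S.k) ≠ ((n + 1 : ℕ) : ZMod S.k) := by
    intro h
    push_cast at h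
    have h1 : (1 : ZMod S.k) = 0 := by linear_combination -h
    have : Fact (1 < S.k) := ⟨hS.two_le_k⟩
    exact one_ne_zero h1
  have hsum : ∀ i, t i - s i = (if t i - s i = ((n + 1 : ℕ) : ZMod S.k) then
      ((n + 1 : ℕ) : ZMod S.k) else 0) - (if t i - s i = (n : ZMod S.k) then
      ((n + 1 : ℕ) : ZMod S.k) else 0) := by
    intro i
    rcases hP.opposite_of_linked hS hk (hne i) (hl i) with h | h
    · rw [h, if_neg hne', if_pos rfl]
      push_cast
      linear_combination hkZ
    · rw [h, if_neg hne'.symm, if_pos rfl, sub_zero]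
  rw [Finset.sum_congr rfl fun i _ => hsum i, Finset.sum_sub_distrib, ← Finset.sum_filter,
    ← Finset.sum_filter, Finset.sum_const, Finset.sum_const, nsmul_eq_mul, nsmul_eq_mul]
  push_cast
  ring

/-! ### Rotation numbers and cycles -/

/-- A consistent choice of rotation numbers for the `0`-complexes `L Ψ_p(𝒦^⟨0⟩)` in `𝒦^⟨1⟩`: giving
the vertex number `s` of the `p`-th complex the label `s + r p` labels each common vertex of two
complexes only once. -/
def IsRotationNumber (S : PlanarIFS) [NeZero S.k] (g ρ : ℂ) (r : Fin S.N → ZMod S.k) : Prop :=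
  ∀ p q s t, p ≠ q → S.Ψ p (S.vertex g ρ s) = S.Ψ q (S.vertex g ρ t) → s + r p = t + r q

/-- The cells of `𝒦^⟨0⟩` are connected through common vertices. -/
lemma eq_of_forall_linked (hS : S.IsSimpleNested) (hP : S.IsPolygon g ρ) {β : Type*}
    (f : Fin S.N → β)
    (hf : ∀ p q s t, p ≠ q → S.Ψ p (S.vertex g ρ s) = S.Ψ q (S.vertex g ρ t) → f p = f q)
    (p q : Fin S.N) : f p = f q := by
  have hcell : ∀ p i s, S.Ψ p (S.vertex g ρ s) ∈ S.Ψ i '' S.K0 → f p = f i := by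
    rintro p i s ⟨y, hy, h⟩
    by_cases hpi : p = i
    · rw [hpi]
    · obtain ⟨s', t', hs, ht⟩ := hP.exists_linked_of_eq hS hpi (hP.vertex_mem_K0 s) hy h.symm
      exact hf p i s t' hpi (by rw [← ht]; exact h.symm)
  have hvert : ∀ a : S.Vneg1, ∃ p s, (a : ℂ) = S.Ψ p (S.vertex g ρ s) := by
    rintro ⟨a, ha⟩
    obtain ⟨p, v, hv, rfl⟩ := mem_iUnion.mp ha
    obtain ⟨s, rfl⟩ := hP.exists_vertex hv
    exact ⟨p, s, rfl⟩
  -- the edges of the cell graph join vertices of the same cell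
  have hwalk : ∀ a b : S.Vneg1, S.cellGraph.Walk a b → ∀ p q s t,
      (a : ℂ) = S.Ψ p (S.vertex g ρ s) → (b : ℂ) = S.Ψ q (S.vertex g ρ t) → f p = f q := by
    intro a b w
    induction w with
    | nil =>
      intro p q s t hp hq
      refine hcell p q s ?_
      rw [← hp, hq]
      exact mem_image_of_mem _ (hP.vertex_mem_K0 t)
    | @cons a a' b h _ ih =>
      intro p q s t hp hq
      obtain ⟨p', s', hp'⟩ := hvert a'
      rw [← ih p' q s' t hp' hq]
      rw [cellGraph, SimpleGraph.fromRel_adj] at h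
      rcases h.2 with ⟨i, h1, h2⟩ | ⟨i, h2, h1⟩
      · rw [hp] at h1
        rw [hp'] at h2
        rw [hcell p i s h1, hcell p' i s' h2]
      · rw [hp] at h1
        rw [hp'] at h2
        rw [hcell p i s h1, hcell p' i s' h2]
  obtain ⟨w⟩ := hS.connectivity.preconnected
    ⟨_, mem_iUnion.mpr ⟨p, _, hP.vertex_mem_V 0, rfl⟩⟩
    ⟨_, mem_iUnion.mpr ⟨q, _, hP.vertex_mem_V 0, rfl⟩⟩
  exact hwalk _ _ w p q 0 0 rfl rfl

/-- Around a cycle the differences of the rotation numbers add up to zero. -/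
lemma IsRotationNumber.dvd (hS : S.IsSimpleNested) (hP : S.IsPolygon g ρ) {o : Fin S.N}
    (ho : S.ν o = 0) (hodd : Odd S.k) {r : Fin S.N → ZMod S.k} (hr : S.IsRotationNumber g ρ r)
    (m : ℕ) [NeZero m] (Δ : Fin m → ℂ) (hΔ : S.IsCycle Δ) :
    (S.k : ℤ) ∣ (S.rotationCount (((S.k : ℝ) + 1) / S.k * Real.pi) Δ : ℤ) -
      (S.rotationCount (((S.k : ℝ) - 1) / S.k * Real.pi) Δ : ℤ) := by
  choose c hc using fun i => exists_cell_of_isInnerComplex hS ho (hΔ.inner i)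
  obtain rfl : Δ = fun i => (S.L : ℂ) * S.ν (c i) := funext hc
  have hlink : ∀ i, ∃ s t, S.Ψ (c i) (S.vertex g ρ s) = S.Ψ (c (i + 1)) (S.vertex g ρ t) := by
    intro i
    obtain ⟨v, h1, h2⟩ := (hΔ.adjacent i).2
    rw [vertices_zero] at h1 h2
    obtain ⟨x, hx, hxv⟩ := h1
    obtain ⟨y, hy, hyv⟩ := h2
    obtain ⟨s, rfl⟩ := hP.exists_vertex hx
    obtain ⟨t, rfl⟩ := hP.exists_vertex hy
    exact ⟨s, t, linked_iff.mpr (hxv.trans hyv.symm)⟩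
  choose s t hl using hlink
  have hne : ∀ i, c i ≠ c (i + 1) := fun i h => (hΔ.adjacent i).1 (by rw [h])
  obtain ⟨n, hn⟩ := hodd
  have h1 := sum_steps_eq hS hP hn c s t hne hl
  have h2 : ∑ i, (t i - s i) = 0 := by
    have h3 : ∀ i, t i - s i = r (c i) - r (c (i + 1)) := by
      intro i
      linear_combination -hr _ _ _ _ (hne i) (hl i)
    rw [Finset.sum_congr rfl fun i _ => h3 i, Finset.sum_sub_distrib, sub_eq_zero]
    exact (Equiv.sum_comp (Equiv.addRight (1 : Fin m)) fun i => r (c i)).symm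
  have h4 : (2 : ZMod S.k) * ((n + 1 : ℕ) : ZMod S.k) = 1 := by
    have : ((2 * n + 1 : ℕ) : ZMod S.k) = 0 := by
      rw [← hn]
      simp
    push_cast at this ⊢
    linear_combination this
  rw [← ZMod.intCast_zmod_eq_zero_iff_dvd]
  rw [h2] at h1
  exact (IsUnit.of_mul_eq_one_right _ h4).mul_right_eq_zero.mp h1.symm

/-- If `k ∣ c - d` for all cycles, rotation numbers exist: they form a potential for the steps
between linked cells. -/
lemma exists_isRotationNumber (hS : S.IsSimpleNested) (hP : S.IsPolygon g ρ) {o : Fin S.N}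
    (ho : S.ν o = 0) (hodd : Odd S.k)
    (hdvd : ∀ (m : ℕ) [NeZero m] (Δ : Fin m → ℂ), S.IsCycle Δ →
      (S.k : ℤ) ∣ (S.rotationCount (((S.k : ℝ) + 1) / S.k * Real.pi) Δ : ℤ) -
        (S.rotationCount (((S.k : ℝ) - 1) / S.k * Real.pi) Δ : ℤ)) :
    ∃ r, S.IsRotationNumber g ρ r := by
  obtain ⟨n, hn⟩ := hodd
  -- a step between linked cells, with the change of the rotation number that it forces
  let E : Fin S.N × ZMod S.k → Fin S.N × ZMod S.k → Prop := fun a b => a.1 ≠ b.1 ∧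
    ∃ s t, S.Ψ a.1 (S.vertex g ρ s) = S.Ψ b.1 (S.vertex g ρ t) ∧ s - t = a.2 - b.2
  have : Nonempty (Fin S.N) := ⟨o⟩
  suffices h : ∃ r : Fin S.N → ZMod S.k, ∀ p q x y, E (p, x) (q, y) → x + r p = y + r q by
    obtain ⟨r, hr⟩ := h
    exact ⟨r, fun p q s t hpq h => hr p q s t ⟨hpq, s, t, h, rfl⟩⟩
  apply exists_potential E
  · rintro a b ⟨hne, s, t, h, hst⟩
    exact ⟨hne.symm, t, s, h.symm, by linear_combination -hst⟩
  · rintro p q x y z ⟨hne, s, t, h, hst⟩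
    exact ⟨hne, s, t, h, by linear_combination hst⟩
  · intro p q
    have h1 := eq_of_forall_linked hS hP
      (fun q => Relation.ReflTransGen (fun p q => ∃ x y, E (p, x) (q, y)) p q)
      (fun a b s t hab h => propext
        ⟨fun h' => h'.tail ⟨s, t, hab, s, t, h, rfl⟩,
          fun h' => h'.tail ⟨t, s, hab.symm, t, s, h.symm, rfl⟩⟩) p q
    exact h1 ▸ Relation.ReflTransGen.refl
  · intro m hm c hc hcm hinj
    have : NeZero m := ⟨hm.ne'⟩
    have hnext : ∀ i : Fin m, (c ((i + 1 : Fin m) : ℕ)).1 = (c (i + 1)).1 := by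
      intro i
      rw [Fin.val_add, Fin.val_one', Nat.add_mod_mod]
      rcases (Nat.succ_le_of_lt i.2).lt_or_eq with h | h
      · rw [Nat.mod_eq_of_lt h]
      · rw [show (i : ℕ) + 1 = m from h, Nat.mod_self, hcm]
    have hE : ∀ i : Fin m, E (c i) (c (i + 1)) := fun i => hc i i.2
    choose hne s t hl hst using hE
    have hne' : ∀ i : Fin m, (c i).1 ≠ (c ((i + 1 : Fin m) : ℕ)).1 := by
      intro i
      rw [hnext]
      exact hne i
    have hl' : ∀ i : Fin m, S.Ψ (c i).1 (S.vertex g ρ (s i)) =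
        S.Ψ (c ((i + 1 : Fin m) : ℕ)).1 (S.vertex g ρ (t i)) := by
      intro i
      rw [hnext]
      exact hl i
    have h1 := sum_steps_eq hS hP hn (fun i : Fin m => (c i).1) s t hne' hl'
    have hcell : Function.Injective fun i : Fin m => (S.L : ℂ) * S.ν (c i).1 := by
      intro i j hij
      have hν := mul_left_cancel₀ S.L_ne_zero hij
      have hc' : (c i).1 = (c j).1 :=
        Ψ_left_injective hS (z := 0) (by rw [Ψ, Ψ, hν])
      exact Fin.ext (hinj i.2 j.2 hc')
    have hcyc : S.IsCycle fun i : Fin m => (S.L : ℂ) * S.ν (c i).1 := by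
      refine ⟨fun i => isInnerComplex_cell ho _,
        (S.complexSet_injective 0).comp hcell, fun i => ⟨?_, ?_⟩⟩
      · intro h
        have hν := mul_left_cancel₀ S.L_ne_zero (S.complexSet_injective 0 h)
        exact hne' i (Ψ_left_injective hS (z := 0) (by rw [Ψ, Ψ, hν]))
      · rw [vertices_zero, vertices_zero]
        exact ⟨_, ⟨_, hP.vertex_mem_V (s i), rfl⟩,
          ⟨_, hP.vertex_mem_V (t i), (linked_iff.mp (hl' i)).symm⟩⟩
    have h2 := hdvd m _ hcyc
    rw [← ZMod.intCast_zmod_eq_zero_iff_dvd] at h2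
    rw [h2, mul_zero] at h1
    have h3 : ∑ i : Fin m, (t i - s i) = (c m).2 - (c 0).2 := by
      have h4 : ∀ i : Fin m, t i - s i = (c (i + 1)).2 - (c i).2 := by
        intro i
        linear_combination -hst i
      rw [Finset.sum_congr rfl fun i _ => h4 i,
        Fin.sum_univ_eq_sum_range (fun i => (c (i + 1)).2 - (c i).2) m,
        Finset.sum_range_sub (fun i => (c i).2) m]
    rw [h3] at h1
    exact sub_eq_zero.mp h1

/-! ### Rotation numbers and good labellings -/

/-- The rotation numbers of the `M`-complexes in `𝒦^⟨M+1⟩` for a good labelling of order `M`. -/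
lemma exists_isRotationNumber_of_hasGLP (hS : S.IsSimpleNested) (hP : S.IsPolygon g ρ)
    {o : Fin S.N} (ho : S.ν o = 0) (h : S.HasGLP) : ∃ r, S.IsRotationNumber g ρ r := by
  obtain ⟨M, ℓ, hbij, hrot⟩ := h
  have hL := S.L_ne_zero
  have hR : ∀ p, ∃ u : ZMod S.k, ∀ (v : S.VMinf M) (s : ZMod S.k),
      (v : ℂ) = (S.L : ℂ) ^ M * S.vertex g ρ s + (S.L : ℂ) ^ (M + 1) * S.ν p →
      ∃ v' : S.VMinf M, (v' : ℂ) = (S.L : ℂ) ^ M * S.vertex g ρ (s + u) ∧ ℓ v = ℓ v' := by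
    intro p
    obtain ⟨R, ⟨i, -, rfl⟩, h⟩ := hrot _ (isComplexShift_cell ho M p)
    refine ⟨(i : ZMod S.k), fun v s hv => ?_⟩
    obtain ⟨u, hu, hℓ⟩ := h v ⟨_, ⟨_, hP.vertex_mem_V s, rfl⟩, hv.symm⟩
    refine ⟨u, ?_, hℓ⟩
    have hexp : Complex.exp (((2 * Real.pi * i / S.k : ℝ) : ℂ) * Complex.I) =
        ZMod.stdAddChar (i : ZMod S.k) := by
      rw [stdAddChar_natCast]
      push_cast
      ring_nf
    rw [hu, rot, hexp, hP.barycenter_eq hS.two_le_k, hv, vertex, vertex, AddChar.map_add_eq_mul]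
    ring
  choose r hr using hR
  refine ⟨r, fun p q s t hpq hlink => ?_⟩
  have hv : (S.L : ℂ) ^ M * S.vertex g ρ s + (S.L : ℂ) ^ (M + 1) * S.ν p =
      (S.L : ℂ) ^ M * S.vertex g ρ t + (S.L : ℂ) ^ (M + 1) * S.ν q := by
    rw [zpow_add₀ hL, zpow_one, ← mul_Ψ, ← mul_Ψ, hlink]
  let v : S.VMinf M := ⟨_, S.vertices_subset_VMinf (isComplexShift_cell ho M p)
    ⟨_, ⟨_, hP.vertex_mem_V s, rfl⟩, rfl⟩⟩
  obtain ⟨v₁, h₁, hℓ₁⟩ := hr p v s rfl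
  obtain ⟨v₂, h₂, hℓ₂⟩ := hr q v t hv
  have heq : v₁ = v₂ := by
    refine hbij.injOn ?_ ?_ (hℓ₁.symm.trans hℓ₂)
    · exact ⟨_, hP.vertex_mem_V _, h₁.symm⟩
    · exact ⟨_, hP.vertex_mem_V _, h₂.symm⟩
  rw [← heq, h₁] at h₂
  exact hP.vertex_injective (mul_left_cancel₀ (zpow_ne_zero M hL) h₂)

/-- The rotation `turn 1` maps rotation numbers to rotation numbers, so it changes them by a
constant `δ`. Hence the rotation number of the cell at the corner number `s` of `𝒦^⟨0⟩` is an
affine function of `s`. -/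
lemma IsRotationNumber.exists_corner (hS : S.IsSimpleNested) (hP : S.IsPolygon g ρ)
    {r : Fin S.N → ZMod S.k} (hr : S.IsRotationNumber g ρ r) :
    ∃ (q : ZMod S.k → Fin S.N) (b δ : ZMod S.k),
      (∀ s, S.Ψ (q s) (S.vertex g ρ s) = S.vertex g ρ s) ∧ ∀ s, r (q s) = b + s * δ := by
  choose q hq using fun s => (hP.vertex_mem_V s).1
  obtain ⟨-, σ, hσ⟩ := hP.isSymm_turn 1
  have hconst := eq_of_forall_linked hS hP (fun p => r (σ p) - r p) (by
    intro p p' s t hne h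
    have h1 := hr _ _ _ _ hne h
    have h2 := hr (σ p) (σ p') (s + 1) (t + 1) (σ.injective.ne hne) (by
      rw [← turn_vertex, ← turn_vertex, ← hσ, ← hσ, h])
    linear_combination h2 - h1)
  set δ := r (σ (q 0)) - r (q 0) with hδ
  have hstep : ∀ s, r (q (s + 1)) = r (q s) + δ := by
    intro s
    have h1 : σ (q s) = q (s + 1) := by
      refine Ψ_left_injective hS (z := S.vertex g ρ (s + 1)) ?_
      rw [hq (s + 1), ← turn_vertex, ← hσ, hq]
    have h2 : r (σ (q s)) - r (q s) = δ := hconst (q s) (q 0)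
    rw [← h1, ← h2]
    ring
  refine ⟨q, r (q 0), δ, hq, fun s => ?_⟩
  have hnat : ∀ n : ℕ, r (q (n : ZMod S.k)) = r (q 0) + n * δ := by
    intro n
    induction n with
    | zero => simp
    | succ n ih =>
      push_cast
      rw [hstep, ih]
      ring
  have := hnat s.val
  rwa [ZMod.natCast_zmod_val] at this

/-- Rotation numbers `r` of the `0`-complexes in `𝒦^⟨1⟩` with `r o = 0` extend to a labelling of
`V_0^⟨∞⟩`. With `r` as in `exists_corner` and `c = 1 + δ`, the vertex number `s` of the complex
with translation vector `∑ L^(j+1) ν_{w j}` gets the label `s + ∑ c^j r (w j)`. The corners of the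
part `L^m 𝒦^⟨0⟩` then have labels `c^m s + const`, so rotation numbers `c^m r` are consistent on the
next level. -/
lemma IsRotationNumber.exists_label (hS : S.IsSimpleNested) (hP : S.IsPolygon g ρ) {o : Fin S.N}
    (ho : S.ν o = 0) {r : Fin S.N → ZMod S.k} (hr : S.IsRotationNumber g ρ r) (hro : r o = 0) :
    ∃ c : ZMod S.k, ∀ (m m' : ℕ) (w w' : ℕ → Fin S.N) (s s' : ZMod S.k),
      S.vertex g ρ s + S.shift w m = S.vertex g ρ s' + S.shift w' m' →
      s + ∑ j ∈ Finset.range m, c ^ j * r (w j) =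
        s' + ∑ j ∈ Finset.range m', c ^ j * r (w' j) := by
  obtain ⟨q, b, δ, hq, hqr⟩ := hr.exists_corner hS hP
  have hL := S.L_ne_zero
  refine ⟨1 + δ, ?_⟩
  set c := 1 + δ with hc
  have hcorner : ∀ (m : ℕ) (u : ZMod S.k),
      S.vertex g ρ u + S.shift (fun _ => q u) m = (S.L : ℂ) ^ m * S.vertex g ρ u := by
    intro m u
    induction m with
    | zero => simp [shift]
    | succ m ih =>
      rw [shift_succ, ← add_assoc, ih, pow_succ, ← mul_Ψ, hq]
  have hlabel : ∀ (m : ℕ) (u : ZMod S.k), u + ∑ j ∈ Finset.range m, c ^ j * r (q u) =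
      c ^ m * u + b * ∑ j ∈ Finset.range m, c ^ j := by
    intro m u
    have hgeom := mul_geom_sum c m
    rw [← Finset.sum_mul, hqr]
    rw [hc, add_sub_cancel_left, ← hc] at hgeom
    linear_combination u * hgeom
  have main : ∀ (m : ℕ) (w w' : ℕ → Fin S.N) (s s' : ZMod S.k),
      S.vertex g ρ s + S.shift w m = S.vertex g ρ s' + S.shift w' m →
      s + ∑ j ∈ Finset.range m, c ^ j * r (w j) =
        s' + ∑ j ∈ Finset.range m, c ^ j * r (w' j) := by
    intro m
    induction m with
    | zero =>
      intro w w' s s' h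
      simp only [shift, Finset.range_zero, Finset.sum_empty, add_zero] at h ⊢
      exact hP.vertex_injective h
    | succ m ih =>
      intro w w' s s' h
      rw [Finset.sum_range_succ, Finset.sum_range_succ]
      by_cases hw : w m = w' m
      · have h1 := ih w w' s s' (by
          rw [shift_succ, shift_succ, hw] at h
          linear_combination h)
        rw [hw]
        linear_combination h1
      · -- the vertex is a corner of both parts of `𝒦^⟨m+1⟩`
        obtain ⟨y, hy, hy'⟩ := exists_add_shift_eq w m (hP.vertex_mem_K0 s)
        obtain ⟨z, hz, hz'⟩ := exists_add_shift_eq w' m (hP.vertex_mem_K0 s')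
        have hyz : S.Ψ (w m) y = S.Ψ (w' m) z := by
          rw [shift_succ, shift_succ, ← add_assoc, ← add_assoc, hy', hz', pow_succ, ← mul_Ψ,
            ← mul_Ψ, ← pow_succ] at h
          exact mul_left_cancel₀ (pow_ne_zero _ hL) h
        obtain ⟨u, u', rfl, rfl⟩ := hP.exists_linked_of_eq hS hw hy hz hyz
        have h1 := ih w (fun _ => q u) s u (by rw [hcorner, hy'])
        have h2 := ih w' (fun _ => q u') s' u' (by rw [hcorner, hz'])
        rw [hlabel] at h1 h2
        have h3 := hr _ _ _ _ hw hyz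
        linear_combination h1 - h2 + c ^ m * h3
  intro m m' w w' s s' h
  have hpad : ∀ (w : ℕ → Fin S.N) {m n : ℕ}, m ≤ n →
      ∑ j ∈ Finset.range n, c ^ j * r (if j < m then w j else o) =
        ∑ j ∈ Finset.range m, c ^ j * r (w j) := by
    intro w m n hmn
    rw [← Finset.sum_range_add_sum_Ico _ hmn]
    have h1 : ∑ j ∈ Finset.Ico m n, c ^ j * r (if j < m then w j else o) = 0 := by
      refine Finset.sum_eq_zero fun j hj => ?_
      rw [if_neg (not_lt.mpr (Finset.mem_Ico.mp hj).1), hro, mul_zero]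
    rw [h1, add_zero]
    refine Finset.sum_congr rfl fun j hj => ?_
    rw [if_pos (Finset.mem_range.mp hj)]
  have := main (max m m') (fun j => if j < m then w j else o) (fun j => if j < m' then w' j else o)
    s s' (by rw [shift_pad ho w (le_max_left _ _), shift_pad ho w' (le_max_right _ _), h])
  rwa [hpad w (le_max_left _ _), hpad w' (le_max_right _ _)] at this

/-- The points of `V_0^⟨m⟩` are the vertices of the `0`-complexes in `𝒦^⟨m⟩`. -/
lemma exists_of_mem_V0 (hP : S.IsPolygon g ρ) {m : ℕ} {v : ℂ} (hv : v ∈ S.V0 m) :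
    ∃ (w : ℕ → Fin S.N) (s : ZMod S.k), v = S.vertex g ρ s + S.shift w m := by
  induction m generalizing v with
  | zero =>
    obtain ⟨s, rfl⟩ := hP.exists_vertex hv
    exact ⟨fun _ => ⟨0, S.N_pos⟩, s, by simp [shift]⟩
  | succ m ih =>
    obtain ⟨i, z, hz, rfl⟩ := mem_iUnion.mp hv
    obtain ⟨w, s, rfl⟩ := ih hz
    refine ⟨fun j => if j < m then w j else i, s, ?_⟩
    have h1 : S.shift (fun j => if j < m then w j else i) m = S.shift w m :=
      Finset.sum_congr rfl fun j hj => by simp only [if_pos (Finset.mem_range.mp hj)]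
    rw [shift_succ, h1]
    simp only [lt_irrefl, if_false]
    ring

/-- The labels of `IsRotationNumber.exists_label` form a good labelling of order `0`; the rotation
for a complex is given by the sum in its labels. -/
lemma IsRotationNumber.hasGLP (hS : S.IsSimpleNested) (hP : S.IsPolygon g ρ) {o : Fin S.N}
    (ho : S.ν o = 0) {r : Fin S.N → ZMod S.k} (hr : S.IsRotationNumber g ρ r) : S.HasGLP := by
  have hr' : S.IsRotationNumber g ρ fun p => r p - r o := by
    intro p q s t hpq h
    linear_combination hr p q s t hpq h
  obtain ⟨c, hc⟩ := hr'.exists_label hS hP ho (sub_self _)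
  have hrepr : ∀ v : S.VMinf 0, ∃ (w : ℕ → Fin S.N) (m : ℕ) (s : ZMod S.k),
      (v : ℂ) = S.vertex g ρ s + S.shift w m := by
    rintro ⟨_, ⟨v, hv, rfl⟩⟩
    obtain ⟨m, hm⟩ := mem_iUnion.mp hv
    obtain ⟨w, s, rfl⟩ := exists_of_mem_V0 hP hm
    exact ⟨w, m, s, by simp⟩
  choose W m σ hrepr using hrepr
  let e : Fin S.k ≃+* ZMod S.k := ZMod.finEquiv S.k
  let label : S.VMinf 0 → ZMod S.k :=
    fun v => σ v + ∑ j ∈ Finset.range (m v), c ^ j * (r (W v j) - r o)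
  have hlabel : ∀ (v : S.VMinf 0) (w : ℕ → Fin S.N) (n : ℕ) (s : ZMod S.k),
      (v : ℂ) = S.vertex g ρ s + S.shift w n →
      label v = s + ∑ j ∈ Finset.range n, c ^ j * (r (w j) - r o) :=
    fun v w n s h => hc _ _ _ _ _ _ ((hrepr v).symm.trans h)
  have hlabel₀ : ∀ (v : S.VMinf 0) (s : ZMod S.k), (v : ℂ) = S.vertex g ρ s → label v = s := by
    intro v s h
    have := hlabel v (fun _ => o) 0 s (by simp [h, shift])
    simpa using this
  have hVM : S.VM 0 = S.V := by simp [VM]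
  have hvert : ∀ s, S.vertex g ρ s ∈ S.VMinf 0 := fun s =>
    S.VM_subset_VMinf 0 (hVM ▸ hP.vertex_mem_V s)
  refine ⟨0, fun v => e.symm (label v), ⟨fun _ _ => mem_univ _, ?_, ?_⟩, ?_⟩
  · intro v hv v' hv' h
    rw [mem_ofPred_eq, hVM] at hv hv'
    obtain ⟨s, hs⟩ := hP.exists_vertex hv
    obtain ⟨s', hs'⟩ := hP.exists_vertex hv'
    have h1 := e.symm.injective h
    rw [hlabel₀ v s hs, hlabel₀ v' s' hs'] at h1
    exact Subtype.ext (by rw [hs, hs', h1])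
  · intro y _
    refine ⟨⟨_, hvert (e y)⟩, ?_, ?_⟩
    · rw [mem_ofPred_eq, hVM]
      exact hP.vertex_mem_V _
    · simp only
      rw [hlabel₀ _ (e y) rfl, RingEquiv.symm_apply_apply]
  · intro a ha
    obtain ⟨w, n, -, rfl⟩ := exists_shift_of_isComplexShift ha
    set u : ZMod S.k := ∑ j ∈ Finset.range n, c ^ j * (r (w j) - r o) with hu
    -- a representative of `u` in `{1, …, k}`
    set i : ℕ := (u - 1).val + 1 with hi
    have hiu : (i : ZMod S.k) = u := by
      rw [hi]
      push_cast
      rw [ZMod.natCast_zmod_val]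
      ring
    refine ⟨_, ⟨i, Finset.mem_Icc.mpr ⟨by omega, ZMod.val_lt (u - 1)⟩, rfl⟩, ?_⟩
    intro v hv
    rw [vertices_zero] at hv
    obtain ⟨x, hx, hxv⟩ := hv
    obtain ⟨s, rfl⟩ := hP.exists_vertex hx
    refine ⟨⟨_, hvert (s + u)⟩, ?_, ?_⟩
    · have hexp : Complex.exp (((2 * Real.pi * i / S.k : ℝ) : ℂ) * Complex.I) =
          ZMod.stdAddChar u := by
        rw [← hiu, stdAddChar_natCast]
        push_cast
        ring_nf
      simp only at hxv ⊢
      rw [rot, hexp, hP.barycenter_eq hS.two_le_k, ← hxv, vertex, vertex,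
        AddChar.map_add_eq_mul, zpow_zero]
      ring
    · simp only
      rw [hlabel₀ ⟨_, hvert (s + u)⟩ (s + u) rfl, hlabel v w n s hxv.symm]

end PlanarIFS

theorem mainTheorem2 (S : PlanarIFS) (hS : S.IsSimpleNested) (h0 : ∃ i, S.ν i = 0)
    (hk : Odd S.k) :
    S.HasGLP ↔
      ∀ (n : ℕ) [NeZero n] (Δ : Fin n → ℂ), S.IsCycle Δ →
        (S.k : ℤ) ∣ (S.rotationCount (((S.k : ℝ) + 1) / S.k * Real.pi) Δ : ℤ) -
          (S.rotationCount (((S.k : ℝ) - 1) / S.k * Real.pi) Δ : ℤ) := by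
  obtain ⟨o, ho⟩ := h0
  have h3 : 3 ≤ S.k := by
    obtain ⟨n, hn⟩ := hk
    have := hS.two_le_k
    omega
  have : NeZero S.k := ⟨by omega⟩
  obtain ⟨g, ρ, hP⟩ := PlanarIFS.exists_isPolygon hS h3 hk
  constructor
  · intro h
    obtain ⟨r, hr⟩ := PlanarIFS.exists_isRotationNumber_of_hasGLP hS hP ho h
    exact fun n _ Δ hΔ => hr.dvd hS hP ho hk n Δ hΔ
  · intro h
    obtain ⟨r, hr⟩ := PlanarIFS.exists_isRotationNumber hS hP ho hk h
    exact hr.hasGLP hS hP ho
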